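/- **Setting.** Let $d\in\{2,3\}$, let $\Omega\subset\mathbb R^d$ be a bounded polyhedral domain with a conforming simplicial triangulation $\mathcal T_h$, $\mathbf n$ the outward unit normal, $r\ge 0$. For $d=2$ a vorticity is a scalar $\omega$, with $\nabla\times\omega=(\partial_2\omega,-\partial_1\omega)$ and $\mathbf n\times\omega=(n_2\omega,-n_1\omega)$. Let $\mathrm d\mathcal P_r$ be the discontinuous elementwise polynomials of degree $\le r$; $\mathrm{RT}_r$ the Raviart–Thomas space (elementwise $\mathcal P_r^d+\mathbf x\widetilde{\mathcal P}_r$, continuous normal component); $\Sigma_{r+1}$ the continuous Lagrange elements of degree $r+1$ if $d=2$ and the first-kind Nédélec elements (elementwise $\mathcal P_r^3+\{\mathbf b\in\widetilde{\mathcal P}_{r+1}^3:\mathbf x\cdot\mathbf b=0\}$, continuous tangential components) if $d=3$. Let $\mathring\Sigma_{r+1}$, $\mathring{\mathrm{RT}}_r$ be the subspaces with $\mathbf n\times\mathbf z=0$, resp. $\mathbf v\cdot\mathbf n=0$, on $\partial\Omega$. Let $(\cdot,\cdot)$ be the elementwise $L^2(\Omega)$ product and $\langle\cdot,\cdot\rangle_{\partial\mathcal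 T_h}=\sum_T\langle\cdot,\cdot\rangle_{L^2(\partial T)}$. On a facet seen from $T$, $\{v\}$ is the mean of the two traces and $[v]$ the trace from $T$ minus the other one; on $\partial\Omega$, $\{v\}=v$ and $[v]=0$. The viscosities $\epsilon_\rho\ge0$, $\epsilon_{\mathbf m}>0$ are elementwise constant, $\zeta,\Delta t>0$, and $\overline p,\overline{\mathbf m}$ are given functions on $\partial\Omega$. The equation of state is $p=\rho^\gamma e^{S/c_v}$, i.e. $\rho(p,S)=(pe^{-S/c_v})^{1/\gamma}$, with $\gamma>1$, $c_v>0$, and $1/c^2=\partial\rho/\partial p$. **One time step.** Given $\rho_h^n\in\mathrm d\mathcal P_r$ positive on every closed element, $\mathbf m_h^n\in\mathrm{RT}_r$ and $S_h^{n+1}\in\mathrm d\mathcal P_r$: 1. $\mathbf m_h^*$, elementwise Raviart–Thomas, satisfies for all $\mathbf v\in\mathrm{RT}_r$ $$(\mathbf m_h^*,\mathbf v)=(\mathbf m_h^n,\mathbf v)-\Delta t\Big[-\big(\tfrac{\mathbf m_h^n\otimes\mathbf m_h^n}{\rho_h^n},\nabla_h\mathbf v\big)+\big\langle(\mathbf m_h^n\cdot\mathbf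 n)\big\{\tfrac{\mathbf m_h^n}{\rho_h^n}\big\}+\tfrac12 s_{\max}[\mathbf m_h^n],\mathbf v\big\rangle_{\partial\mathcal T_h}\Big],$$ where $s_{\max}$ is the larger of $2|\tfrac{\mathbf m_h^n}{\rho_h^n}\cdot\mathbf n|$ on the two sides of the facet. 2. Newton iteration: from $p^0\in\mathrm d\mathcal P_r$ find, for $l=0,1,\dots$, $(\boldsymbol\omega^{l+1},\mathbf m^{l+1},p^{l+1})\in W\times V\times\mathrm d\mathcal P_r$ such that, with $\rho^{0}=\rho_h^n$, $\rho^{l}=\rho(p^l,S_h^{n+1})$ for $l\ge1$, and $c_l^{-2}=c^{-2}(p^l,S_h^{n+1})$, for all $(\mathbf z,\mathbf v,q)\in W\times V\times\mathrm d\mathcal P_r$, $$(c_l^{-2}p^{l+1},q)+\Delta t(\nabla\cdot\mathbf m^{l+1},q)=(\rho_h^n-\rho^l+c_l^{-2}p^l,q),$$ $$(\mathbf m^{l+1},\mathbf v)-\Delta t(p^{l+1},\nabla\cdot\mathbf v)+\Delta t(\epsilon_{\mathbf m}\nabla\cdot\mathbf m^{l+1},\nabla\cdot\mathbf v)+\Delta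 t(\nabla\times\boldsymbol\omega^{l+1},\mathbf v)=(\mathbf m_h^*,\mathbf v)-\Delta t\langle\overline p,\mathbf v\cdot\mathbf n\rangle_{\partial\Omega},\qquad(\ast)$$ $$(\epsilon_{\mathbf m}^{-1}\boldsymbol\omega^{l+1},\mathbf z)-(\mathbf m^{l+1},\nabla\times\mathbf z)=\langle\mathbf n\times\overline{\mathbf m},\mathbf z\rangle_{\partial\Omega}.$$ Here $(W,V)$ is $(\Sigma_{r+1},\mathrm{RT}_r)$ (outflow), $(\mathring\Sigma_{r+1},\mathring{\mathrm{RT}}_r)$ (slip) or $(\Sigma_{r+1},\mathring{\mathrm{RT}}_r)$ (Dirichlet). 3. If the iterates converge in $L^2(\Omega)$ to $(\boldsymbol\omega_h^{n+1},\mathbf m_h^{n+1},p_h^{n+1})\in W\times V\times\mathrm d\mathcal P_r$, then $\rho_h^{n+1}\in\mathrm d\mathcal P_r$ satisfies, for all $q\in\mathrm d\mathcal P_r$, $$(\rho_h^{n+1},q)+\Delta t\,a_{\epsilon_\rho}(\rho_h^{n+1},q)=(\rho_h^n,q)-\Delta t(\nabla\cdot\mathbf m_h^{n+1},q),$$ $$a_\epsilon(p,q)=(\epsilon\nabla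 p,\nabla q)+\langle\tfrac{\zeta\epsilon}{h}[p],[q]\rangle_{\partial\mathcal T_h}-\langle\{\epsilon\nabla p\}\cdot\mathbf n,[q]\rangle_{\partial\mathcal T_h}-\langle\{\epsilon\nabla q\}\cdot\mathbf n,[p]\rangle_{\partial\mathcal T_h},$$ with $h$ the diameter of the element. Call a function $P$ on $\partial\Omega$ a *boundary pressure* of the step if $P=\overline p$ in the outflow case, or if $(\boldsymbol\omega_h^{n+1},\mathbf m_h^{n+1},p_h^{n+1})$ satisfies $(\ast)$ with $P$ in place of $\overline p$ for all $\mathbf v\in\mathrm{RT}_r$ ($P$ is then the Lagrange multiplier of the condition on $\mathbf m\cdot\mathbf n$ in the slip and Dirichlet cases). **Theorem.** Assume that the Newton iteration converges and that $\mathbf m_h^n\cdot\mathbf n$, $\mathbf m_h^{n+1}\cdot\mathbf n$ and $\mathbf n\times\boldsymbol\omega_h^{n+1}$ vanish on $\partial\Omega$. (a) If $\epsilon_\rho=0$, mass is conserved locally: $$\int_T\rho_h^{n+1}\,dx=\int_T\rho_h^n\,dx-\Delta t\int_{\partial T}\mathbf m_h^{n+1}\cdot\mathbf n\,dS\qquad\forall\,T\in\mathcal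 T_h .$$ (b) For every boundary pressure $P$ of the step, $$\int_\Omega\mathbf m_h^{n+1}\,dx=\int_\Omega\mathbf m_h^n\,dx-\Delta t\int_{\partial\Omega}P\,\mathbf n\,dS .$$ In particular, if $\int_{\partial\Omega}P\,\mathbf n\,dS=0$ (for instance $\overline p=0$ in the outflow case), momentum is conserved globally: $\int_\Omega\mathbf m_h^{n+1}\,dx=\int_\Omega\mathbf m_h^n\,dx$. (c) If $\epsilon_\rho=0$, or if $\nabla\rho_h^{n+1}\cdot\mathbf n=0$ on $\partial\Omega$, mass is conserved globally: $\int_\Omega\rho_h^{n+1}\,dx=\int_\Omega\rho_h^n\,dx$. -/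

import Mathlib

open MeasureTheory Filter Topology

noncomputable section

namespace SemiImplicitFEM

/-! ### Points, polynomials, elementwise polynomial fields -/

/-- Points of `ℝ^d`. -/
abbrev Pt (d : ℕ) := EuclideanSpace ℝ (Fin d)

/-- Real polynomials in `d` variables. -/
abbrev Poly (d : ℕ) := MvPolynomial (Fin d) ℝ

/-- An elementwise polynomial scalar function: one polynomial for each element `T` of a mesh, an
element being given by the finite set of its vertices. Only the values at elements of the mesh
under consideration are ever used. Its trace on a facet is double-valued in general. -/
abbrev ScalarField (d : ℕ) := Finset (Pt d) → Poly d

/-- An elementwise polynomial function with values in `ℝ^k`. -/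
abbrev VectorField (d k : ℕ) := Finset (Pt d) → Fin k → Poly d

/-- The value of a polynomial at a point. -/
def ev {d : ℕ} (p : Poly d) (x : Pt d) : ℝ := MvPolynomial.eval (fun i => x i) p

/-- The vector of values of a tuple of polynomials at a point. -/
def evV {d k : ℕ} (p : Fin k → Poly d) (x : Pt d) : Fin k → ℝ := fun i => ev (p i) x

/-- The divergence of a polynomial vector field. -/
def divP {d : ℕ} (v : Fin d → Poly d) : Poly d := ∑ i, MvPolynomial.pderiv i (v i)

/-- The gradient of a polynomial. -/
def gradP {d : ℕ} (p : Poly d) : Fin d → Poly d := fun i => MvPolynomial.pderiv i p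

/-- Number of components of the vorticity: a scalar in the plane, a vector in space. -/
def vdim : ℕ → ℕ
  | 2 => 1
  | 3 => 3
  | _ => 0

/-- The curl of the vorticity: the rotated gradient `(∂₂ω, -∂₁ω)` of a scalar in the plane, the
usual curl in space. -/
def curlP : (d : ℕ) → (Fin (vdim d) → Poly d) → (Fin d → Poly d)
  | 2, w =>
      ![MvPolynomial.pderiv 1 (w (0 : Fin 1)), -MvPolynomial.pderiv 0 (w (0 : Fin 1))]
  | 3, w =>
      ![MvPolynomial.pderiv 1 (w (2 : Fin 3)) - MvPolynomial.pderiv 2 (w (1 : Fin 3)),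
        MvPolynomial.pderiv 2 (w (0 : Fin 3)) - MvPolynomial.pderiv 0 (w (2 : Fin 3)),
        MvPolynomial.pderiv 0 (w (1 : Fin 3)) - MvPolynomial.pderiv 1 (w (0 : Fin 3))]
  | _, _ => 0

/-- `n × ω` for a vorticity value `ω`: in the plane `ω` stands for `(0, 0, ω)`. -/
def crossVort : (d : ℕ) → (Fin d → ℝ) → (Fin (vdim d) → ℝ) → (Fin d → ℝ)
  | 2, n, w => ![n 1 * w (0 : Fin 1), -(n 0 * w (0 : Fin 1))]
  | 3, n, w =>
      ![n 1 * w (2 : Fin 3) - n 2 * w (1 : Fin 3),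
        n 2 * w (0 : Fin 3) - n 0 * w (2 : Fin 3),
        n 0 * w (1 : Fin 3) - n 1 * w (0 : Fin 3)]
  | _, _, _ => 0

/-- `n × m` for a momentum value `m`: the scalar `n₁ m₂ - n₂ m₁` in the plane. -/
def crossMom : (d : ℕ) → (Fin d → ℝ) → (Fin d → ℝ) → (Fin (vdim d) → ℝ)
  | 2, n, m => fun _ => n 0 * m 1 - n 1 * m 0
  | 3, n, m =>
      ![n 1 * m 2 - n 2 * m 1, n 2 * m 0 - n 0 * m 2, n 0 * m 1 - n 1 * m 0]
  | _, _, _ => 0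

/-! ### Triangulations -/

/-- The closed simplex with vertex set `T`. -/
def hull {d : ℕ} (T : Finset (Pt d)) : Set (Pt d) := convexHull ℝ (T : Set (Pt d))

/-- A conforming simplicial triangulation of the polyhedral domain `Ω ⊆ ℝ^d`: finitely many
nondegenerate `d`-simplices, any two of which meet in a common face, and whose union fills `Ω`. -/
structure Triangulation {d : ℕ} (Ω : Set (Pt d)) where
  /-- the elements, each given by its vertices -/
  cells : Finset (Finset (Pt d))
  card_cell : ∀ T ∈ cells, T.card = d + 1
  indep : ∀ T ∈ cells, AffineIndependent ℝ ((↑) : T → Pt d)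
  conforming : ∀ T ∈ cells, ∀ T' ∈ cells,
    hull T ∩ hull T' ⊆ convexHull ℝ ((T : Set (Pt d)) ∩ (T' : Set (Pt d)))
  fills : interior (⋃ T ∈ cells, hull T) = Ω

/-- The facets of a `d`-simplex, each given by its `d` vertices. -/
def facets {d : ℕ} (T : Finset (Pt d)) : Finset (Finset (Pt d)) := T.powersetCard d

/-- The unit normal to the facet `e` of the simplex `T`, pointing out of `T`: the component
orthogonal to `e` of the vector from the centroid of `T` to the centroid of `e`, normalized. -/
def normal {d : ℕ} (T e : Finset (Pt d)) : Pt d :=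
  let w : Pt d := ((vectorSpan ℝ (e : Set (Pt d)))ᗮ).starProjection
    (e.centroid ℝ id - T.centroid ℝ id)
  ‖w‖⁻¹ • w

/-- The outward unit normal as a tuple of coordinates. -/
def nrm {d : ℕ} (T e : Finset (Pt d)) : Fin d → ℝ := fun i => normal T e i

/-- Integral over the element `T` (Lebesgue measure). -/
def cellInt {d : ℕ} (T : Finset (Pt d)) (f : Pt d → ℝ) : ℝ := ∫ x in hull T, f x

/-- Integral over the facet `e` (surface measure). -/
def facetInt {d : ℕ} (e : Finset (Pt d)) (f : Pt d → ℝ) : ℝ := ∫ x in hull e, f x ∂μHE[d - 1]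

namespace Triangulation

variable {d : ℕ} {Ω : Set (Pt d)} (M : Triangulation Ω)

/-- The facet `e` of the element `T` is internal: another element has it as a facet. -/
def IsInternal (T e : Finset (Pt d)) : Prop := ∃ T' ∈ M.cells, T' ≠ T ∧ e ⊆ T'

/-- The facet `e` of the element `T` lies on `∂Ω`. -/
def IsBoundary (T e : Finset (Pt d)) : Prop := ¬ M.IsInternal T e

open Classical in
/-- The element on the other side of the facet `e` of `T` if `e` is internal; `T` itself if `e` is a
boundary facet. -/
def opp (T e : Finset (Pt d)) : Finset (Pt d) :=
  if h : M.IsInternal T e then h.choose else T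

/-- Integral over `Ω` of an elementwise defined function. -/
def domInt (f : Finset (Pt d) → Pt d → ℝ) : ℝ := ∑ T ∈ M.cells, cellInt T (f T)

/-- Integral over the skeleton `∂𝒯_h`, internal facets being counted once from each side. The
integrand gets the element `T`, its facet `e` and the point. -/
def skelInt (f : Finset (Pt d) → Finset (Pt d) → Pt d → ℝ) : ℝ :=
  ∑ T ∈ M.cells, ∑ e ∈ facets T, facetInt e (f T e)

open Classical in
/-- Integral over `∂Ω`. -/
def bdryInt (f : Finset (Pt d) → Finset (Pt d) → Pt d → ℝ) : ℝ :=
  ∑ T ∈ M.cells, ∑ e ∈ facets T with M.IsBoundary T e, facetInt e (f T e)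

/-- The average `{f}` on the facet `e`, as seen from `T`; the own value on boundary facets. -/
def avg (f : Finset (Pt d) → Pt d → ℝ) (T e : Finset (Pt d)) (x : Pt d) : ℝ :=
  (f T x + f (M.opp T e) x) / 2

/-- The jump `[f]` on the facet `e`, as seen from `T`: own value minus the value on the other side;
zero on boundary facets. -/
def jump (f : Finset (Pt d) → Pt d → ℝ) (T e : Finset (Pt d)) (x : Pt d) : ℝ :=
  f T x - f (M.opp T e) x

/-! ### Finite element spaces -/

/-- `q ∈ dP_r`: discontinuous elementwise polynomials of degree at most `r`. -/
def IsDG (r : ℕ) (q : ScalarField d) : Prop := ∀ T ∈ M.cells, (q T).totalDegree ≤ r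

/-- On each element `v` is a Raviart-Thomas polynomial, `v ∈ P_r^d + x P̃_r` with `P̃_r` the
homogeneous polynomials of degree `r`. -/
def IsBrokenRT (r : ℕ) (v : VectorField d d) : Prop :=
  ∀ T ∈ M.cells, ∃ (a : Fin d → Poly d) (b : Poly d),
    (∀ i, (a i).totalDegree ≤ r) ∧ b.IsHomogeneous r ∧
      ∀ i, v T i = a i + MvPolynomial.X i * b

/-- `v ∈ RT_r`: elementwise Raviart-Thomas with continuous normal component. -/
def IsRT (r : ℕ) (v : VectorField d d) : Prop :=
  M.IsBrokenRT r v ∧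
    ∀ T ∈ M.cells, ∀ T' ∈ M.cells, ∀ e, e ∈ facets T → e ∈ facets T' → ∀ x ∈ hull e,
      evV (v T) x ⬝ᵥ nrm T e = evV (v T') x ⬝ᵥ nrm T e

/-- `v · n = 0` on `∂Ω`. -/
def ZeroNormalTrace (v : VectorField d d) : Prop :=
  ∀ T ∈ M.cells, ∀ e ∈ facets T, M.IsBoundary T e → ∀ x ∈ hull e, evV (v T) x ⬝ᵥ nrm T e = 0

/-- `n × z = 0` on `∂Ω`. -/
def ZeroTangentialTrace (z : VectorField d (vdim d)) : Prop :=
  ∀ T ∈ M.cells, ∀ e ∈ facets T, M.IsBoundary T e → ∀ x ∈ hull e,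
    crossVort d (nrm T e) (evV (z T) x) = 0

end Triangulation

/-- Local space of `Σ_{r+1}`: polynomials of degree at most `r + 1` in the plane; in space the
first-kind Nédélec polynomials `P_r^3 + {b ∈ P̃_{r+1}^3 : x · b = 0}`. -/
def IsLocalSigma : (d : ℕ) → ℕ → (Fin (vdim d) → Poly d) → Prop
  | 2, r, w => (w (0 : Fin 1)).totalDegree ≤ r + 1
  | 3, r, w => ∃ a b : Fin 3 → Poly 3,
      (∀ i, (a i).totalDegree ≤ r) ∧ (∀ i, (b i).IsHomogeneous (r + 1)) ∧
        (∑ i, MvPolynomial.X i * b i = 0) ∧ w = fun i => a i + b i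
  | _, _, _ => False

/-- Conformity of `Σ_{r+1}`: continuity in the plane, continuity of the tangential components across
facets in space. -/
def IsSigmaConforming : (d : ℕ) → {Ω : Set (Pt d)} → Triangulation Ω →
    VectorField d (vdim d) → Prop
  | 2, _, M, z => ∀ T ∈ M.cells, ∀ T' ∈ M.cells, ∀ x ∈ hull T ∩ hull T',
      evV (z T) x = evV (z T') x
  | 3, _, M, z => ∀ T ∈ M.cells, ∀ T' ∈ M.cells, ∀ e, e ∈ facets T → e ∈ facets T' →
      ∀ x ∈ hull e, crossVort 3 (nrm T e) (evV (z T) x) = crossVort 3 (nrm T e) (evV (z T') x)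
  | _, _, _, _ => False

/-- The three choices of essential boundary conditions: none (`outflow`), on vorticity and
momentum (`slip`), on the momentum only (`dirichlet`). -/
inductive BC
  | outflow
  | slip
  | dirichlet

namespace Triangulation

variable {d : ℕ} {Ω : Set (Pt d)} (M : Triangulation Ω)

/-- `z ∈ Σ_{r+1}`. -/
def IsSigma (r : ℕ) (z : VectorField d (vdim d)) : Prop :=
  (∀ T ∈ M.cells, IsLocalSigma d r (z T)) ∧ IsSigmaConforming d M z

/-- The vorticity space of the scheme: `Σ_{r+1}`, with `n × z = 0` on `∂Ω` for `slip`. -/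
def VorticitySpace (bc : BC) (r : ℕ) (z : VectorField d (vdim d)) : Prop :=
  M.IsSigma r z ∧ (bc = BC.slip → M.ZeroTangentialTrace z)

/-- The momentum space of the scheme: `RT_r`, with `v · n = 0` on `∂Ω` unless `outflow`. -/
def MomentumSpace (bc : BC) (r : ℕ) (v : VectorField d d) : Prop :=
  M.IsRT r v ∧ (bc ≠ BC.outflow → M.ZeroNormalTrace v)

/-! ### Explicit convection of the momentum -/

/-- The larger of twice the normal velocities `|m/ρ · n|` on the two sides of the facet. -/
def sMax (ρ : ScalarField d) (m : VectorField d d) (T e : Finset (Pt d)) (x : Pt d) : ℝ :=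
  max (2 * |(evV (m T) x ⬝ᵥ nrm T e) / ev (ρ T) x|)
    (2 * |(evV (m (M.opp T e)) x ⬝ᵥ nrm T e) / ev (ρ (M.opp T e)) x|)

/-- Component `i` of the Ducros-type numerical flux `(m · n) {m / ρ} + (1/2) s_max [m]`. -/
def numFlux (ρ : ScalarField d) (m : VectorField d d) (i : Fin d) (T e : Finset (Pt d))
    (x : Pt d) : ℝ :=
  (evV (m T) x ⬝ᵥ nrm T e) * M.avg (fun K y => ev (m K i) y / ev (ρ K) y) T e x
    + 1 / 2 * M.sMax ρ m T e x * M.jump (fun K y => ev (m K i) y) T e x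

/-- `mS` is the momentum after the explicit convection step, with momentum flux
`(m ⊗ m) / ρ` discretized by the DG method. -/
def IsConvected (r : ℕ) (Δt : ℝ) (ρ : ScalarField d) (m mS : VectorField d d) : Prop :=
  M.IsBrokenRT r mS ∧ ∀ v : VectorField d d, M.IsRT r v →
    M.domInt (fun T x => evV (mS T) x ⬝ᵥ evV (v T) x)
      = M.domInt (fun T x => evV (m T) x ⬝ᵥ evV (v T) x)
        - Δt * (- M.domInt (fun T x => ∑ i, ∑ j,
              ev (m T i) x * ev (m T j) x / ev (ρ T) x * ev (MvPolynomial.pderiv j (v T i)) x)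
            + M.skelInt (fun T e x => ∑ i, M.numFlux ρ m i T e x * ev (v T i) x))

end Triangulation

/-! ### Equation of state -/

/-- The density as a function of pressure and entropy for the ideal gas law
`p = ρ^γ exp(S / c_v)`. -/
def densityOf (γ cv p S : ℝ) : ℝ := (p * Real.exp (-(S / cv))) ^ (1 / γ)

/-- `1 / c² = ∂ρ/∂p`. -/
def invSoundSq (γ cv p S : ℝ) : ℝ := deriv (fun p' => densityOf γ cv p' S) p

/-- The given data of one time step: gas constants, time step, elementwise constant viscosities
`ε_ρ` and `ε_m`, penalty parameter, boundary pressure and boundary momentum. -/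
structure StepData (d : ℕ) where
  γ : ℝ
  cv : ℝ
  Δt : ℝ
  ερ : Finset (Pt d) → ℝ
  εm : Finset (Pt d) → ℝ
  ζ : ℝ
  pbar : Pt d → ℝ
  mbar : Pt d → Fin d → ℝ

namespace Triangulation

variable {d : ℕ} {Ω : Set (Pt d)} (M : Triangulation Ω)

/-! ### Newton iteration -/

/-- The discrete momentum equation for the unknowns `(ω, m, p)`, tested with `v`, where `P` is the
pressure on `∂Ω`. -/
def MomentumEq (D : StepData d) (mS : VectorField d d)
    (ω : VectorField d (vdim d)) (m : VectorField d d) (p : ScalarField d) (P : Pt d → ℝ)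
    (v : VectorField d d) : Prop :=
  M.domInt (fun T x => evV (m T) x ⬝ᵥ evV (v T) x)
      - D.Δt * M.domInt (fun T x => ev (p T) x * ev (divP (v T)) x)
      + D.Δt * M.domInt (fun T x => D.εm T * ev (divP (m T)) x * ev (divP (v T)) x)
      + D.Δt * M.domInt (fun T x => evV (curlP d (ω T)) x ⬝ᵥ evV (v T) x)
    = M.domInt (fun T x => evV (mS T) x ⬝ᵥ evV (v T) x)
      - D.Δt * M.bdryInt (fun T e x => P x * (evV (v T) x ⬝ᵥ nrm T e))

/-- `P` is a boundary pressure of the discrete state `(ω, m, p)`: a Lagrange multiplier for the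
condition on `m · n` with which the momentum equation holds for all test functions in `RT_r`, also
for those with nonzero normal component on `∂Ω`. -/
def IsBoundaryPressure (r : ℕ) (D : StepData d) (mS : VectorField d d)
    (ω : VectorField d (vdim d)) (m : VectorField d d) (p : ScalarField d) (P : Pt d → ℝ) : Prop :=
  ∀ v : VectorField d d, M.IsRT r v → M.MomentumEq D mS ω m p P v

/-- One Newton iteration with `l` the iteration counter: from the old pressure iterate `p` to the
new vorticity, momentum and pressure `ω', m', p'`. The old density iterate is `ρⁿ` for `l = 0` and
`ρ(p, S)` afterwards. -/
def NewtonStep (bc : BC) (r : ℕ) (D : StepData d) (ρn S : ScalarField d) (mS : VectorField d d)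
    (l : ℕ) (p : ScalarField d)
    (ω' : VectorField d (vdim d)) (m' : VectorField d d) (p' : ScalarField d) : Prop :=
  M.VorticitySpace bc r ω' ∧ M.MomentumSpace bc r m' ∧ M.IsDG r p' ∧
  (∀ q : ScalarField d, M.IsDG r q →
    M.domInt (fun T x => invSoundSq D.γ D.cv (ev (p T) x) (ev (S T) x)
          * ev (p' T) x * ev (q T) x)
        + D.Δt * M.domInt (fun T x => ev (divP (m' T)) x * ev (q T) x)
      = M.domInt (fun T x =>
          (ev (ρn T) x
            - (if l = 0 then ev (ρn T) x else densityOf D.γ D.cv (ev (p T) x) (ev (S T) x))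
            + invSoundSq D.γ D.cv (ev (p T) x) (ev (S T) x) * ev (p T) x) * ev (q T) x)) ∧
  (∀ v : VectorField d d, M.MomentumSpace bc r v → M.MomentumEq D mS ω' m' p' D.pbar v) ∧
  (∀ z : VectorField d (vdim d), M.VorticitySpace bc r z →
    M.domInt (fun T x => 1 / D.εm T * (evV (ω' T) x ⬝ᵥ evV (z T) x))
        - M.domInt (fun T x => evV (m' T) x ⬝ᵥ evV (curlP d (z T)) x)
      = M.bdryInt (fun T e x => crossMom d (nrm T e) (D.mbar x) ⬝ᵥ evV (z T) x))

/-- Convergence in `L²(Ω)` of elementwise polynomial scalar functions. -/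
def L2Tendsto (f : ℕ → ScalarField d) (g : ScalarField d) : Prop :=
  Tendsto (fun l => M.domInt (fun T x => (ev (f l T) x - ev (g T) x) ^ 2)) atTop (𝓝 0)

/-- Convergence in `L²(Ω)` of elementwise polynomial vector functions. -/
def L2TendstoV {k : ℕ} (f : ℕ → VectorField d k) (g : VectorField d k) : Prop :=
  Tendsto (fun l => M.domInt (fun T x => ∑ i, (ev (f l T i) x - ev (g T i) x) ^ 2)) atTop (𝓝 0)

/-- The Newton iteration, started at some pressure in `dP_r`, converges to `(ω, m, p)`. -/
def NewtonConverges (bc : BC) (r : ℕ) (D : StepData d) (ρn S : ScalarField d)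
    (mS : VectorField d d)
    (ω : VectorField d (vdim d)) (m : VectorField d d) (p : ScalarField d) : Prop :=
  M.VorticitySpace bc r ω ∧ M.MomentumSpace bc r m ∧ M.IsDG r p ∧
  ∃ (ωs : ℕ → VectorField d (vdim d)) (ms : ℕ → VectorField d d) (ps : ℕ → ScalarField d),
    M.IsDG r (ps 0) ∧
    (∀ l, M.NewtonStep bc r D ρn S mS l (ps l) (ωs (l + 1)) (ms (l + 1)) (ps (l + 1))) ∧
    M.L2TendstoV ωs ω ∧ M.L2TendstoV ms m ∧ M.L2Tendsto ps p

/-! ### Density update -/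

/-- The interior penalty form `a_ε(p, q)`, with `ε` constant on each element and the mesh size `h`
of an element its diameter. -/
def sip (ε : Finset (Pt d) → ℝ) (ζ : ℝ) (p q : ScalarField d) : ℝ :=
  M.domInt (fun T x => ε T * (evV (gradP (p T)) x ⬝ᵥ evV (gradP (q T)) x))
    + M.skelInt (fun T e x => ζ * ε T / Metric.diam (hull T)
        * M.jump (fun K y => ev (p K) y) T e x * M.jump (fun K y => ev (q K) y) T e x)
    - M.skelInt (fun T e x =>
        (∑ i, M.avg (fun K y => ε K * ev (gradP (p K) i) y) T e x * nrm T e i)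
          * M.jump (fun K y => ev (q K) y) T e x)
    - M.skelInt (fun T e x =>
        (∑ i, M.avg (fun K y => ε K * ev (gradP (q K) i) y) T e x * nrm T e i)
          * M.jump (fun K y => ev (p K) y) T e x)

/-- `ρ'` is the density obtained from `ρ` with the converged momentum `m`. -/
def IsDensityUpdate (r : ℕ) (D : StepData d) (ρ : ScalarField d) (m : VectorField d d)
    (ρ' : ScalarField d) : Prop :=
  M.IsDG r ρ' ∧ ∀ q : ScalarField d, M.IsDG r q →
    M.domInt (fun T x => ev (ρ' T) x * ev (q T) x) + D.Δt * M.sip D.ερ D.ζ ρ' q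
      = M.domInt (fun T x => ev (ρ T) x * ev (q T) x)
        - D.Δt * M.domInt (fun T x => ev (divP (m T)) x * ev (q T) x)

/-- `∇ρ · n = 0` on `∂Ω`. -/
def ZeroNormalDerivative (ρ : ScalarField d) : Prop :=
  ∀ T ∈ M.cells, ∀ e ∈ facets T, M.IsBoundary T e → ∀ x ∈ hull e,
    evV (gradP (ρ T)) x ⬝ᵥ nrm T e = 0

end Triangulation

end SemiImplicitFEM

end

open SemiImplicitFEM

noncomputable section

namespace SemiImplicitFEM

/-! Everything follows by testing with constants: the coordinate vectors lie in `RT_r`, while the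
constant 1 and the indicator of an element lie in `dP_r`. In the convection step, the derivative of
a constant test field is zero and the numerical flux changes sign when a facet is seen from the
other element. The mean momentum is therefore preserved once `mn · n = 0` on the boundary. In the
momentum equation the pressure and grad-div terms drop out. Apart from the boundary pressure only
the mean of `∇ × ω` remains; each of its components is the divergence of a field whose normal flux
is a component of `n × ω`. It becomes a sum over facets that cancels inside by conformity and
vanishes on the boundary. For the mass, each term of the interior penalty form contains `∇q` or
`[q]`, so the form vanishes at `q = 1`. If `ε_ρ = 0` it vanishes identically, and the indicator of
an element gives the local balance.

Two tools carry the argument. The divergence theorem on a simplex, `cellInt_divP`, is proved in edge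
directions by Fubini and the fundamental theorem of calculus on a reference simplex, and extended by
linearity because edges span. The cancellation principle `skelInt_eq_zero` rests on `normal_eq_neg`:
conformity places two elements with a common facet on opposite sides of it, so a facet has at most
two elements.

For outflow conditions the momentum equation is known only for the Newton iterates. Tested with a
constant, it involves linear functionals of polynomials of bounded degree, which are continuous in
`L²` because this space is finite dimensional (`tendsto_of_cellInt_sq_tendsto_zero`). Otherwise, a
boundary pressure provides the equation for all test fields in `RT_r`, constants included. -/

/-! ### Integration over simplices -/

/-- The simplex spanned by the origin and the coordinate vectors. -/
def refSimplex (m : ℕ) : Set (Fin m → ℝ) := {t | (∀ i, 0 ≤ t i) ∧ ∑ i, t i ≤ 1}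

theorem convex_refSimplex (m : ℕ) : Convex ℝ (refSimplex m) := by
  intro x hx y hy a b ha hb hab
  refine ⟨fun i => ?_, ?_⟩
  · have := hx.1 i
    have := hy.1 i
    simp only [Pi.add_apply, Pi.smul_apply, smul_eq_mul]
    positivity
  · simp only [Pi.add_apply, Pi.smul_apply, smul_eq_mul, Finset.sum_add_distrib, ← Finset.mul_sum]
    nlinarith [mul_le_mul_of_nonneg_left hx.2 ha, mul_le_mul_of_nonneg_left hy.2 hb]

theorem isClosed_refSimplex (m : ℕ) : IsClosed (refSimplex m) := by
  simp only [refSimplex, Set.ofPred_and, Set.ofPred_forall]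
  exact (isClosed_iInter fun i => isClosed_le (by fun_prop) (by fun_prop)).inter
    (isClosed_le (by fun_prop) (by fun_prop))

theorem isCompact_refSimplex (m : ℕ) : IsCompact (refSimplex m) := by
  refine (isCompact_univ_pi fun _ : Fin m => isCompact_Icc (a := (0 : ℝ)) (b := 1)).of_isClosed_subset
    (isClosed_refSimplex m) fun t ht i _ => ⟨ht.1 i, ?_⟩
  exact (Finset.single_le_sum (fun j _ => ht.1 j) (Finset.mem_univ i)).trans ht.2

theorem convexHull_insert_range_eq_image {d m : ℕ} (p : Pt d) (w : Fin m → Pt d) :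
    convexHull ℝ (insert p (Set.range w))
      = (fun t : Fin m → ℝ => p + ∑ j, t j • (w j - p)) '' refSimplex m := by
  apply Set.Subset.antisymm
  · refine convexHull_min ?_ ?_
    · rintro x (rfl | ⟨j, rfl⟩)
      · exact ⟨0, ⟨by simp, by simp⟩, by simp⟩
      · refine ⟨Pi.single j 1, ⟨fun i => ?_, by simp⟩, by simp [Pi.single_apply, ite_smul]⟩
        by_cases h : i = j
        · subst h; simp
        · simp [h]
    · have h := ((convex_refSimplex m).linear_image
        (∑ j, (LinearMap.proj (R := ℝ) (φ := fun _ : Fin m => ℝ) j).smulRight (w j - p))).translate p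
      rw [Set.image_image] at h
      simpa using h
  · rintro _ ⟨t, ht, rfl⟩
    -- The barycentric weights are `t j` at `w j` and the remainder `1 - ∑ t j` at `p`.
    have key := (convex_convexHull ℝ (insert p (Set.range w))).sum_mem (t := Finset.univ)
      (w := (Fin.cons (1 - ∑ j, t j) t : Fin (m + 1) → ℝ))
      (z := (Fin.cons p w : Fin (m + 1) → Pt d)) ?_ ?_ ?_
    · convert key using 1
      simp only [Fin.sum_univ_succ, Fin.cons_zero, Fin.cons_succ, smul_sub, sub_smul, one_smul,
        Finset.sum_sub_distrib, Finset.sum_smul]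
      abel
    · intro i _
      refine Fin.cases ?_ (fun j => ?_) i
      · simpa using ht.2
      · simpa using ht.1 j
    · simp [Fin.sum_univ_succ]
    · intro i _
      refine Fin.cases ?_ (fun j => ?_) i
      · exact subset_convexHull ℝ _ (Set.mem_insert _ _)
      · exact subset_convexHull ℝ _ (Set.mem_insert_of_mem _ ⟨j, rfl⟩)

theorem isometry_orthonormal_combination {d m : ℕ} {b : Fin m → Pt d} (hb : Orthonormal ℝ b)
    (p : Pt d) : Isometry (fun y : EuclideanSpace ℝ (Fin m) => p + ∑ k, y k • b k) := by
  refine Isometry.of_dist_eq fun x y => ?_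
  rw [dist_add_left, dist_eq_norm, dist_eq_norm, ← Finset.sum_sub_distrib]
  simp only [← sub_smul]
  rw [← sq_eq_sq₀ (norm_nonneg _) (norm_nonneg _), ← real_inner_self_eq_norm_sq,
    hb.inner_sum, EuclideanSpace.norm_sq_eq]
  simp [sq]

/-- Change of variables from a simplex to the reference simplex. -/
theorem setIntegral_convexHull_insert_range {d m : ℕ} {b : Fin m → Pt d} (hb : Orthonormal ℝ b)
    (p : Pt d) (w : Fin m → Pt d) (A : Matrix (Fin m) (Fin m) ℝ)
    (hA : ∀ j, w j - p = ∑ k, A k j • b k) (hdet : A.det ≠ 0) (f : Pt d → ℝ) :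
    ∫ x in convexHull ℝ (insert p (Set.range w)), f x ∂μHE[m]
      = |A.det| * ∫ t in refSimplex m, f (p + ∑ j, t j • (w j - p)) := by
  set ψ : EuclideanSpace ℝ (Fin m) → Pt d := fun y => p + ∑ k, y k • b k with hψ
  have hiso : Isometry ψ := isometry_orthonormal_combination hb p
  have hcomp : ∀ t : Fin m → ℝ,
      p + ∑ j, t j • (w j - p) = ψ (WithLp.toLp 2 (Matrix.toLin' A t)) := by
    intro t
    simp only [hψ, hA, Finset.smul_sum, Matrix.toLin'_apply, Matrix.mulVec, dotProduct,
      Finset.sum_smul, smul_smul]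
    rw [Finset.sum_comm]
    simp only [mul_comm]
  have himg : convexHull ℝ (insert p (Set.range w))
      = ψ '' (WithLp.toLp 2 '' (Matrix.toLin' A '' refSimplex m)) := by
    rw [convexHull_insert_range_eq_image, Set.image_image, Set.image_image]
    simp only [hcomp]
  have hme : MeasurableEmbedding ψ := hiso.isClosedEmbedding.measurableEmbedding
  have hmeas : MeasurableSet (convexHull ℝ (insert p (Set.range w))) := by
    refine IsCompact.measurableSet ?_
    rw [convexHull_insert_range_eq_image]
    exact (isCompact_refSimplex m).image (by fun_prop)
  have hsub : convexHull ℝ (insert p (Set.range w)) ⊆ Set.range ψ := by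
    rw [himg]; exact Set.image_subset_range _ _
  -- An isometry carries Lebesgue measure on `ℝ^m` to the Hausdorff measure restricted to its range,
  -- and this range contains the simplex.
  have h1 : (μHE[m] : Measure (Pt d)).restrict (convexHull ℝ (insert p (Set.range w)))
      = (Measure.map ψ volume).restrict (convexHull ℝ (insert p (Set.range w))) := by
    rw [← EuclideanSpace.euclideanHausdorffMeasure_eq_volume, hiso.map_euclideanHausdorffMeasure,
      Measure.restrict_restrict hmeas, Set.inter_eq_left.2 hsub]
  rw [h1, hme.setIntegral_map, himg, Set.preimage_image_eq _ hiso.injective]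
  have h2 := ((EuclideanSpace.volume_preserving_symm_measurableEquiv_toLp (Fin m)).symm
    ).setIntegral_image_emb (MeasurableEquiv.measurableEmbedding _) (fun y => f (ψ y))
      (Matrix.toLin' A '' refSimplex m)
  have h3 := integral_image_eq_integral_abs_det_fderiv_smul (volume : Measure (Fin m → ℝ))
    (isClosed_refSimplex m).measurableSet
    (f := Matrix.toLin' A) (f' := fun _ => (Matrix.toLin' A).toContinuousLinearMap)
    (fun x _ => (Matrix.toLin' A).toContinuousLinearMap.hasFDerivWithinAt)
    (fun x _ y _ h => by
      have : Function.Injective A.mulVec :=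
        Matrix.mulVec_injective_iff_isUnit.2 ((Matrix.isUnit_iff_isUnit_det A).2 hdet.isUnit)
      exact this (by simpa using h))
    (fun y => f (ψ (WithLp.toLp 2 y)))
  refine (h2.trans h3).trans ?_
  simp only [smul_eq_mul, hcomp, integral_const_mul]
  congr 2
  simp [ContinuousLinearMap.det]

/-- Integration of a partial derivative over the reference simplex. -/
theorem setIntegral_refSimplex_succ {n : ℕ} {g g' : (Fin (n + 1) → ℝ) → ℝ}
    (hg' : Continuous g')
    (hder : ∀ (y : Fin n → ℝ) (s : ℝ), HasDerivAt (fun s => g (Fin.cons s y)) (g' (Fin.cons s y)) s) :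
    ∫ t in refSimplex (n + 1), g' t
      = ∫ y in refSimplex n, (g (Fin.cons (1 - ∑ i, y i) y) - g (Fin.cons 0 y)) := by
  -- The slice over `y` is the interval from 0 to `1 - ∑ y i`; after Fubini the fundamental theorem
  -- of calculus is applied on it.
  have hmem : ∀ (s : ℝ) (y : Fin n → ℝ), (Fin.cons s y : Fin (n + 1) → ℝ) ∈ refSimplex (n + 1) ↔
      y ∈ refSimplex n ∧ s ∈ Set.Icc 0 (1 - ∑ i, y i) := by
    intro s y
    simp only [refSimplex, Set.mem_ofPred_eq, Fin.forall_fin_succ, Fin.cons_zero, Fin.cons_succ,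
      Fin.sum_univ_succ, Set.mem_Icc]
    constructor
    · rintro ⟨⟨h1, h2⟩, h3⟩
      exact ⟨⟨h2, by linarith⟩, h1, by linarith⟩
    · rintro ⟨⟨h2, _⟩, h1, h3⟩
      exact ⟨⟨h1, h2⟩, by linarith⟩
  have hm := (isClosed_refSimplex (n + 1)).measurableSet
  have hint : Integrable ((refSimplex (n + 1)).indicator g') :=
    (integrable_indicator_iff hm).2 (hg'.continuousOn.integrableOn_compact (isCompact_refSimplex _))
  have hmp := (volume_preserving_piFinSuccAbove (fun _ : Fin (n + 1) => ℝ) 0).symm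
  rw [← integral_indicator hm, ← hmp.integral_comp (MeasurableEquiv.measurableEmbedding _),
    Measure.volume_eq_prod, integral_prod_symm,
    ← integral_indicator (isClosed_refSimplex n).measurableSet]
  · congr 1
    funext y
    have hcons : ∀ x : ℝ, Fin.insertNthEquiv (fun _ : Fin (n + 1) => ℝ) 0 (x, y) = Fin.cons x y :=
      fun x => Fin.insertNth_zero' x y
    simp only [MeasurableEquiv.piFinSuccAbove_symm_apply, hcons]
    by_cases hy : y ∈ refSimplex n
    · rw [Set.indicator_of_mem hy]
      have : (fun s : ℝ => (refSimplex (n + 1)).indicator g' (Fin.cons s y))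
          = (Set.Icc 0 (1 - ∑ i, y i)).indicator (fun s => g' (Fin.cons s y)) := by
        funext s
        by_cases hs : s ∈ Set.Icc 0 (1 - ∑ i, y i)
        · rw [Set.indicator_of_mem hs, Set.indicator_of_mem ((hmem s y).2 ⟨hy, hs⟩)]
        · rw [Set.indicator_of_notMem hs, Set.indicator_of_notMem fun h => hs ((hmem s y).1 h).2]
      refine (congrArg (fun F : ℝ → ℝ => ∫ s, F s) this).trans ?_
      rw [integral_indicator measurableSet_Icc, integral_Icc_eq_integral_Ioc,
        ← intervalIntegral.integral_of_le (by linarith [hy.2])]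
      refine intervalIntegral.integral_eq_sub_of_hasDerivAt (fun s _ => hder y s) ?_
      refine Continuous.intervalIntegrable (hg'.comp ?_) _ _
      refine continuous_pi fun i => ?_
      refine Fin.cases ?_ (fun j => ?_) i
      · simpa using continuous_id'
      · simpa using continuous_const
    · rw [Set.indicator_of_notMem hy]
      refine (integral_congr_ae (Eventually.of_forall fun s => ?_)).trans (integral_zero _ _)
      exact Set.indicator_of_notMem (fun h => hy ((hmem s y).1 h).1) _
  · exact (hmp.integrable_comp_emb (MeasurableEquiv.measurableEmbedding _)).2 hint

/-! ### Polynomials as functions -/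

section Evaluation

variable {d : ℕ}

@[simp] theorem ev_C (a : ℝ) (x : Pt d) : ev (MvPolynomial.C a) x = a := by simp [ev]

@[simp] theorem ev_X (i : Fin d) (x : Pt d) : ev (MvPolynomial.X i) x = x i := by simp [ev]

@[simp] theorem ev_zero (x : Pt d) : ev 0 x = 0 := by simp [ev]

@[simp] theorem ev_one (x : Pt d) : ev 1 x = 1 := by simp [ev]

@[simp] theorem ev_neg (p : Poly d) (x : Pt d) : ev (-p) x = -ev p x := by simp [ev]

@[simp] theorem ev_add (p q : Poly d) (x : Pt d) : ev (p + q) x = ev p x + ev q x := by simp [ev]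

@[simp] theorem ev_sub (p q : Poly d) (x : Pt d) : ev (p - q) x = ev p x - ev q x := by simp [ev]

@[simp] theorem ev_mul (p q : Poly d) (x : Pt d) : ev (p * q) x = ev p x * ev q x := by simp [ev]

@[simp] theorem ev_smul (a : ℝ) (p : Poly d) (x : Pt d) : ev (a • p) x = a * ev p x := by
  simp [ev, MvPolynomial.smul_eval]

theorem continuous_ev (f : Poly d) : Continuous (ev f) := by
  induction f using MvPolynomial.induction_on with
  | C a =>
    have : ev (MvPolynomial.C a) = fun _ : Pt d => a := funext fun x => ev_C a x
    rw [this]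
    exact continuous_const
  | add p q hp hq =>
    rw [show ev (p + q) = fun x => ev p x + ev q x from funext fun x => ev_add p q x]
    exact hp.add hq
  | mul_X p i hp =>
    rw [show ev (p * MvPolynomial.X i) = fun x => ev p x * x i from funext fun x => by simp]
    exact hp.mul (by fun_prop)

theorem hasDerivAt_ev (f : Poly d) (x u : Pt d) (s : ℝ) :
    HasDerivAt (fun s : ℝ => ev f (x + s • u))
      (∑ i, ev (MvPolynomial.pderiv i f) (x + s • u) * u i) s := by
  induction f using MvPolynomial.induction_on with
  | C a => simpa using hasDerivAt_const s a
  | add p q hp hq =>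
    have := hp.add hq
    rw [← Finset.sum_add_distrib] at this
    simpa [Pi.add_def, add_mul] using this
  | mul_X p i hp =>
    have hX : HasDerivAt (fun s : ℝ => x i + s * u i) (u i) s := by
      simpa using ((hasDerivAt_id s).mul_const (u i)).const_add (x i)
    refine ((hp.mul hX).congr_deriv ?_).congr_of_eventuallyEq
      (Eventually.of_forall fun s => by simp)
    simp only [Derivation.leibniz, MvPolynomial.pderiv_X, smul_eq_mul, ev_add, ev_mul, ev_X,
      add_mul, Finset.sum_add_distrib, Finset.sum_mul, PiLp.add_apply, PiLp.smul_apply]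
    rw [add_comm]
    congr 1
    · rw [Finset.sum_eq_single i]
      · simp
      · intro j _ hj
        simp [hj.symm]
      · simp
    · rw [← Finset.sum_add_distrib]
      exact Finset.sum_congr rfl fun j _ => by ring

end Evaluation

theorem isCompact_hull {d : ℕ} (T : Finset (Pt d)) : IsCompact (hull T) :=
  T.finite_toSet.isCompact_convexHull ℝ

theorem measurableSet_hull {d : ℕ} (T : Finset (Pt d)) : MeasurableSet (hull T) :=
  (isCompact_hull T).measurableSet

theorem integrableOn_hull {d : ℕ} (T : Finset (Pt d)) {f : Pt d → ℝ} (hf : Continuous f) :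
    IntegrableOn f (hull T) :=
  hf.continuousOn.integrableOn_compact (isCompact_hull T)

/-! ### Normals -/

/-- Facets are indexed by their opposite vertices from here on. -/
theorem facets_eq_image_erase {d : ℕ} {T : Finset (Pt d)} [DecidableEq (Pt d)]
    (hT : T.card = d + 1) : facets T = T.image fun a => T.erase a := by
  ext e
  simp only [facets, Finset.mem_powersetCard, Finset.mem_image]
  constructor
  · rintro ⟨hs, hc⟩
    have h1 : (T \ e).card = 1 := by rw [Finset.card_sdiff_of_subset hs]; omega
    obtain ⟨a, ha⟩ := Finset.card_eq_one.1 h1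
    have haT : a ∈ T \ e := by rw [ha]; simp
    refine ⟨a, (Finset.mem_sdiff.1 haT).1, ?_⟩
    rw [Finset.erase_eq, ← ha, Finset.sdiff_sdiff_eq_self hs]
  · rintro ⟨a, ha, rfl⟩
    exact ⟨Finset.erase_subset _ _, by rw [Finset.card_erase_of_mem ha]; omega⟩

theorem sum_facets {d : ℕ} {T : Finset (Pt d)} [DecidableEq (Pt d)] (hT : T.card = d + 1)
    (F : Finset (Pt d) → ℝ) : ∑ e ∈ facets T, F e = ∑ a ∈ T, F (T.erase a) := by
  rw [facets_eq_image_erase hT, Finset.sum_image]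
  intro a ha b hb h
  by_contra hab
  have : a ∈ T.erase b := Finset.mem_erase.2 ⟨hab, ha⟩
  have h' : T.erase a = T.erase b := h
  rw [← h'] at this
  simp at this

theorem centroid_eq_smul_sum {d : ℕ} {s : Finset (Pt d)} (hs : s.Nonempty) :
    s.centroid ℝ id = (s.card : ℝ)⁻¹ • ∑ x ∈ s, x := by
  rw [Finset.centroid_def, Finset.affineCombination_eq_linear_combination _ _ _
    (s.sum_centroidWeights_eq_one_of_nonempty ℝ hs)]
  simp [Finset.smul_sum]

/-- Modulo directions in the facet, the vector defining `normal` is a positive multiple of `p - a`,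
for any vertex `p` of the facet. -/
theorem centroid_erase_sub_centroid {d : ℕ} [DecidableEq (Pt d)] {T : Finset (Pt d)} {a p : Pt d}
    (ha : a ∈ T) (hp : p ∈ T.erase a) :
    ∃ z ∈ vectorSpan ℝ ((T.erase a : Finset (Pt d)) : Set (Pt d)),
      (T.erase a).centroid ℝ id - T.centroid ℝ id = (T.card : ℝ)⁻¹ • (p - a) + z := by
  set e := T.erase a with he
  have hne : e.Nonempty := ⟨p, hp⟩
  have hcard : (T.card : ℝ) = e.card + 1 := by
    rw [he, ← Finset.card_erase_add_one ha]; push_cast; ring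
  have hpos : (0 : ℝ) < e.card := by exact_mod_cast hne.card_pos
  have hsum : ∑ x ∈ T, x = a + ∑ x ∈ e, x := (Finset.add_sum_erase T id ha).symm
  refine ⟨((T.card : ℝ)⁻¹) • (e.centroid ℝ id - p), ?_, ?_⟩
  · refine Submodule.smul_mem _ _ ?_
    rw [centroid_eq_smul_sum hne]
    have : (e.card : ℝ)⁻¹ • ∑ x ∈ e, x - p = (e.card : ℝ)⁻¹ • ∑ x ∈ e, (x - p) := by
      rw [Finset.sum_sub_distrib, Finset.sum_const, smul_sub, ← Nat.cast_smul_eq_nsmul ℝ,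
        smul_smul, inv_mul_cancel₀ hpos.ne', one_smul]
    rw [this]
    exact Submodule.smul_mem _ _ (Submodule.sum_mem _ fun x hx =>
      vsub_mem_vectorSpan ℝ (Finset.mem_coe.2 hx) (Finset.mem_coe.2 hp))
  · rw [centroid_eq_smul_sum hne, centroid_eq_smul_sum ⟨a, ha⟩, hsum, hcard]
    have h1 : (e.card : ℝ) + 1 ≠ 0 := by positivity
    have h2 : (e.card : ℝ) ≠ 0 := hpos.ne'
    match_scalars <;> field_simp <;> ring

section Normal

variable {d : ℕ} {T : Finset (Pt d)}

theorem normal_mem_orthogonal (T e : Finset (Pt d)) :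
    normal T e ∈ (vectorSpan ℝ (e : Set (Pt d)))ᗮ :=
  Submodule.smul_mem _ _ (Submodule.starProjection_apply_mem _ _)

theorem inner_normal_sub_eq_zero (T : Finset (Pt d)) {e : Finset (Pt d)} {p q : Pt d} (hp : p ∈ e)
    (hq : q ∈ e) : inner ℝ (normal T e) (p - q) = 0 := by
  rw [real_inner_comm]
  exact normal_mem_orthogonal T e _
    (vsub_mem_vectorSpan ℝ (Finset.mem_coe.2 hp) (Finset.mem_coe.2 hq))

variable [DecidableEq (Pt d)]

theorem sub_notMem_vectorSpan_erase (hT : AffineIndependent ℝ ((↑) : T → Pt d)) {a p : Pt d}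
    (ha : a ∈ T) (hp : p ∈ T.erase a) :
    p - a ∉ vectorSpan ℝ ((T.erase a : Finset (Pt d)) : Set (Pt d)) := by
  intro h
  have h1 := hT.notMem_affineSpan_sdiff ⟨a, ha⟩ Set.univ
  apply h1
  have himg : ((↑) : T → Pt d) '' (Set.univ \ {⟨a, ha⟩}) = ((T.erase a : Finset (Pt d)) : Set (Pt d)) := by
    ext x
    simp [and_comm]
  rw [himg]
  have hp' : p ∈ affineSpan ℝ ((T.erase a : Finset (Pt d)) : Set (Pt d)) :=
    subset_affineSpan ℝ _ (Finset.mem_coe.2 hp)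
  have := AffineSubspace.vadd_mem_of_mem_direction
    (by rw [direction_affineSpan]; exact Submodule.neg_mem _ h) hp'
  simpa using this

/-- The normal is the normalized orthogonal projection of `p - a`. This projection is nonzero
because `a` lies off the affine span of the facet, and its inner product with `p - a` is its squared
norm. -/
theorem norm_normal_and_inner_pos (hT : AffineIndependent ℝ ((↑) : T → Pt d)) {a p : Pt d}
    (ha : a ∈ T) (hp : p ∈ T.erase a) : ‖normal T (T.erase a)‖ = 1 ∧
      0 < inner ℝ (normal T (T.erase a)) (p - a) := by
  obtain ⟨z, hz, hc⟩ := centroid_erase_sub_centroid ha hp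
  set K := vectorSpan ℝ ((T.erase a : Finset (Pt d)) : Set (Pt d)) with hK
  set w : Pt d := Kᗮ.starProjection ((T.erase a).centroid ℝ id - T.centroid ℝ id) with hw
  have hT0 : (0 : ℝ) < (T.card : ℝ)⁻¹ := by
    have : 0 < T.card := Finset.card_pos.2 ⟨a, ha⟩
    positivity
  have hwP : w = (T.card : ℝ)⁻¹ • Kᗮ.starProjection (p - a) := by
    have hz0 : Kᗮ.starProjection z = 0 := by
      rw [Submodule.starProjection_apply_eq_zero_iff, Submodule.orthogonal_orthogonal]
      exact hz
    rw [hw, hc, map_add, map_smul, hz0, add_zero]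
  have hP : Kᗮ.starProjection (p - a) ≠ 0 := by
    intro h
    rw [Submodule.starProjection_apply_eq_zero_iff, Submodule.orthogonal_orthogonal] at h
    exact sub_notMem_vectorSpan_erase hT ha hp h
  have hw0 : w ≠ 0 := by
    rw [hwP]; exact smul_ne_zero hT0.ne' hP
  have hn : normal T (T.erase a) = ‖w‖⁻¹ • w := rfl
  refine ⟨by rw [hn]; exact norm_smul_inv_norm (𝕜 := ℝ) hw0, ?_⟩
  rw [hn, inner_smul_left, hwP, inner_smul_left]
  have hin : inner ℝ (Kᗮ.starProjection (p - a)) (p - a) = ‖Kᗮ.starProjection (p - a)‖ ^ 2 := by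
    rw [← real_inner_self_eq_norm_sq]
    conv_rhs => rw [Submodule.inner_starProjection_left_eq_right,
      Submodule.starProjection_eq_self_iff.2 (Submodule.starProjection_apply_mem Kᗮ (p - a))]
    exact Submodule.inner_starProjection_left_eq_right _ _ _
  rw [hin]
  have : 0 < ‖w‖ := norm_pos_iff.2 hw0
  rw [← hwP]
  have : 0 < ‖Kᗮ.starProjection (p - a)‖ := norm_pos_iff.2 hP
  simp only [conj_trivial]
  positivity

end Normal

/-! ### The divergence theorem on a simplex -/

/-- The determinant of the coordinates of `d` vectors. -/
def frameDet {d : ℕ} (v : Fin d → Pt d) : ℝ := (Matrix.of fun i j => v i j).det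

/-- The change between two orthonormal bases has determinant `±1`. -/
theorem abs_det_inner_eq_abs_frameDet {d : ℕ} (b : OrthonormalBasis (Fin d) ℝ (Pt d))
    (v : Fin d → Pt d) :
    |(Matrix.of fun i j => inner ℝ (b j) (v i)).det| = |frameDet v| := by
  set e := EuclideanSpace.basisFun (Fin d) ℝ with he
  have h1 : (Matrix.of fun i j => inner ℝ (b j) (v i)).det = b.toBasis.det v := by
    rw [Module.Basis.det_apply, ← Matrix.det_transpose]
    congr 1
    ext i j
    simp [Module.Basis.toMatrix_apply, b.repr_apply_apply]
  have h2 : frameDet v = e.toBasis.det v := by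
    rw [Module.Basis.det_apply, ← Matrix.det_transpose, frameDet]
    rfl
  rw [h1, h2]
  have h3 : e.toBasis.det v = e.toBasis.det b * b.toBasis.det v := by
    simp only [Module.Basis.det_apply]
    rw [← Matrix.det_mul]
    congr 1
    have := e.toBasis.toMatrix_mul_toMatrix (b' := b.toBasis) (b'' := v)
    simpa using this.symm
  rw [h3, abs_mul]
  rcases e.det_to_matrix_orthonormalBasis_real b with h | h <;> rw [h] <;> simp

theorem frameDet_ne_zero {d : ℕ} {v : Fin d → Pt d} (hv : LinearIndependent ℝ v) :
    frameDet v ≠ 0 := by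
  have h : LinearIndependent ℝ (Matrix.of fun i j => v i j).row := by
    have := hv.map' (WithLp.linearEquiv 2 ℝ (Fin d → ℝ)).toLinearMap (LinearEquiv.ker _)
    exact this
  exact ((Matrix.isUnit_iff_isUnit_det _).1 (Matrix.linearIndependent_rows_iff_isUnit.1 h)).ne_zero

/-- A shear: it allows the base point of the edges `w j - q` to be moved from `q` to `p` in the
presence of the edge `p - q`. -/
theorem frameDet_cons_add {n : ℕ} (u : Pt (n + 1)) (v : Fin n → Pt (n + 1)) (c : ℝ) :
    frameDet (Fin.cons u fun j => v j + c • u) = frameDet (Fin.cons u v) := by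
  refine Matrix.det_eq_of_forall_row_eq_smul_add_const (Fin.cons 0 fun _ => c) 0 (by simp) ?_
  intro i j
  refine Fin.cases ?_ (fun k => ?_) i <;> simp

theorem frameDet_cons_neg {n : ℕ} (u : Pt (n + 1)) (v : Fin n → Pt (n + 1)) :
    frameDet (Fin.cons (-u) v) = -frameDet (Fin.cons u v) := by
  have := Matrix.det_updateRow_smul (Matrix.of fun i j => (Fin.cons u v : Fin (n + 1) → Pt (n + 1)) i j)
    0 (-1) (fun j => u j)
  have h1 : (Matrix.of fun i j => (Fin.cons (-u) v : Fin (n + 1) → Pt (n + 1)) i j)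
      = (Matrix.of fun i j => (Fin.cons u v : Fin (n + 1) → Pt (n + 1)) i j).updateRow 0
        ((-1 : ℝ) • fun j => u j) := by
    ext i j
    refine Fin.cases ?_ (fun k => ?_) i <;> simp
  have h2 : (Matrix.of fun i j => (Fin.cons u v : Fin (n + 1) → Pt (n + 1)) i j).updateRow 0
        (fun j => u j) = (Matrix.of fun i j => (Fin.cons u v : Fin (n + 1) → Pt (n + 1)) i j) := by
    ext i j
    refine Fin.cases ?_ (fun k => ?_) i <;> simp
  rw [frameDet, frameDet, h1, this, h2]
  ring

/-- Volume of a simplex in terms of the reference simplex. -/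
theorem setIntegral_simplex {d : ℕ} (q : Pt d) (v : Fin d → Pt d)
    (hdet : frameDet (fun j => v j - q) ≠ 0) (f : Pt d → ℝ) :
    ∫ x in convexHull ℝ (insert q (Set.range v)), f x
      = |frameDet fun j => v j - q| * ∫ t in refSimplex d, f (q + ∑ j, t j • (v j - q)) := by
  set e := EuclideanSpace.basisFun (Fin d) ℝ with he
  have h := setIntegral_convexHull_insert_range e.orthonormal q v
    (Matrix.of fun i j => (v i - q) j).transpose ?_ ?_ f
  · rw [EuclideanSpace.euclideanHausdorffMeasure_eq_volume, Matrix.det_transpose] at h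
    exact h
  · intro j
    have := e.sum_repr (v j - q)
    rw [← this]
    simp [he]
  · rw [Matrix.det_transpose]
    exact hdet

/-- Height times base is the volume of the frame. -/
theorem inner_mul_setIntegral_facet {n : ℕ} {N p q : Pt (n + 1)} {w : Fin n → Pt (n + 1)}
    (hN : ‖N‖ = 1) (hw : ∀ j, inner ℝ N (w j - p) = 0) (hpos : 0 < inner ℝ N (p - q))
    (hdet : frameDet (Fin.cons (p - q) fun j => w j - p) ≠ 0) (f : Pt (n + 1) → ℝ) :
    inner ℝ N (p - q) * ∫ x in convexHull ℝ (insert p (Set.range w)), f x ∂μHE[n]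
      = |frameDet (Fin.cons (p - q) fun j => w j - p)|
        * ∫ t in refSimplex n, f (p + ∑ j, t j • (w j - p)) := by
  -- In an orthonormal basis starting with `N`, the vectors `w j - p` have no first coordinate, so
  -- the determinant of the frame splits into height times base determinant.
  obtain ⟨b, hb⟩ := Orthonormal.exists_orthonormalBasis_extension_of_card_eq (𝕜 := ℝ)
    (E := Pt (n + 1)) (ι := Fin (n + 1)) (by simp) (v := fun _ => N) (s := {0}) (by
      constructor
      · rintro ⟨i, hi⟩; simpa using hN
      · rintro ⟨i, hi⟩ ⟨j, hj⟩ hij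
        rw [Set.mem_singleton_iff] at hi hj
        subst hi; subst hj
        exact absurd rfl hij)
  have hb0 : b 0 = N := hb 0 rfl
  set A : Matrix (Fin n) (Fin n) ℝ := Matrix.of fun k j => inner ℝ (b k.succ) (w j - p) with hA
  have hdetA : (Matrix.of fun i j =>
        inner ℝ (b j) ((Fin.cons (p - q) fun j => w j - p : Fin (n + 1) → Pt (n + 1)) i)).det
      = inner ℝ N (p - q) * A.det := by
    rw [Matrix.det_succ_column_zero, Fin.sum_univ_succ, Finset.sum_eq_zero, add_zero]
    · rw [← Matrix.det_transpose A]
      simp only [Matrix.of_apply, Fin.cons_zero, hb0]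
      simp only [Fin.val_zero, pow_zero, one_mul]
      rfl
    · intro i _
      simp [hb0, hw]
  have habs := abs_det_inner_eq_abs_frameDet b
    (Fin.cons (p - q) fun j => w j - p : Fin (n + 1) → Pt (n + 1))
  rw [hdetA, abs_mul, abs_of_pos hpos] at habs
  have hA0 : A.det ≠ 0 := by
    intro h
    rw [h, abs_zero, mul_zero] at habs
    exact hdet (abs_eq_zero.1 habs.symm)
  rw [setIntegral_convexHull_insert_range (b := fun k => b k.succ)
    (b.orthonormal.comp _ (Fin.succ_injective n)) p w A ?_ hA0, ← mul_assoc, habs]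
  intro j
  conv_lhs => rw [← b.sum_repr (w j - p)]
  rw [Fin.sum_univ_succ, b.repr_apply_apply, hb0, hw, zero_smul, zero_add]
  simp only [hA, Matrix.of_apply, b.repr_apply_apply]

theorem exists_simplex_enumeration {n : ℕ} [DecidableEq (Pt (n + 1))] {T : Finset (Pt (n + 1))}
    (hc : T.card = n + 2) (hT : AffineIndependent ℝ ((↑) : T → Pt (n + 1))) {p q : Pt (n + 1)}
    (hp : p ∈ T) (hq : q ∈ T) (hpq : p ≠ q) :
    ∃ w : Fin n → Pt (n + 1),
      ((T.erase q : Finset (Pt (n + 1))) : Set (Pt (n + 1))) = insert p (Set.range w) ∧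
      ((T.erase p : Finset (Pt (n + 1))) : Set (Pt (n + 1))) = insert q (Set.range w) ∧
      frameDet (Fin.cons (p - q) fun j => w j - q) ≠ 0 := by
  set S := (T.erase q).erase p with hS
  have hpq' : p ∈ T.erase q := Finset.mem_erase.2 ⟨hpq, hp⟩
  have hcS : S.card = n := by
    rw [hS, Finset.card_erase_of_mem hpq', Finset.card_erase_of_mem hq]; omega
  set w : Fin n → Pt (n + 1) := fun j => (S.equivFinOfCardEq hcS).symm j with hw
  have hwS : ∀ j, w j ∈ S := fun j => ((S.equivFinOfCardEq hcS).symm j).2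
  have hinj : Function.Injective w :=
    Subtype.val_injective.comp (S.equivFinOfCardEq hcS).symm.injective
  have hrange : Set.range w = (S : Set (Pt (n + 1))) := by
    ext x
    constructor
    · rintro ⟨j, rfl⟩; exact hwS j
    · intro hx
      exact ⟨S.equivFinOfCardEq hcS ⟨x, hx⟩, by simp [hw]⟩
  have hS' : S = (T.erase p).erase q := by rw [hS, Finset.erase_right_comm]
  have hqp' : q ∈ T.erase p := Finset.mem_erase.2 ⟨hpq.symm, hq⟩
  refine ⟨w, ?_, ?_, ?_⟩
  · rw [hrange, ← Finset.coe_insert, hS, Finset.insert_erase hpq']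
  · rw [hrange, ← Finset.coe_insert, hS', Finset.insert_erase hqp']
  · have hwT : ∀ j, w j ∈ T := fun j => Finset.mem_of_mem_erase (Finset.mem_of_mem_erase (hwS j))
    have hwp : ∀ j, w j ≠ p := fun j => (Finset.mem_erase.1 (hwS j)).1
    have hwq : ∀ j, w j ≠ q := fun j =>
      (Finset.mem_erase.1 (Finset.mem_of_mem_erase (hwS j))).1
    have hLI := (affineIndependent_iff_linearIndependent_vsub ℝ _ (⟨q, hq⟩ : T)).1 hT
    let u : Fin (n + 1) → {x : T // x ≠ ⟨q, hq⟩} :=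
      Fin.cons ⟨⟨p, hp⟩, fun h => hpq (congrArg Subtype.val h)⟩
        fun j => ⟨⟨w j, hwT j⟩, fun h => hwq j (congrArg Subtype.val h)⟩
    have hu : Function.Injective u := by
      refine Fin.cons_injective_iff.2 ⟨?_, ?_⟩
      · rintro ⟨j, hj⟩
        exact hwp j (congrArg (fun x : {x : T // x ≠ ⟨q, hq⟩} => (x.1 : Pt (n + 1))) hj)
      · intro i j hij
        exact hinj (congrArg (fun x : {x : T // x ≠ ⟨q, hq⟩} => (x.1 : Pt (n + 1))) hij)
    refine frameDet_ne_zero ?_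
    have hcomp : (Fin.cons (p - q) fun j => w j - q : Fin (n + 1) → Pt (n + 1))
        = (fun i : {x : T // x ≠ ⟨q, hq⟩} => (i : Pt (n + 1)) -ᵥ ((⟨q, hq⟩ : T) : Pt (n + 1))) ∘ u := by
      funext i
      refine Fin.cases ?_ (fun j => ?_) i <;> simp [u]
    rw [hcomp]
    exact hLI.comp u hu

/-- The divergence theorem in the direction of an edge. Only the two facets opposite its end points
are not parallel to it, hence only these appear. -/
theorem setIntegral_derivative_edge {n : ℕ} [DecidableEq (Pt (n + 1))] {T : Finset (Pt (n + 1))}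
    (hc : T.card = n + 2) (hT : AffineIndependent ℝ ((↑) : T → Pt (n + 1))) {p q : Pt (n + 1)}
    (hp : p ∈ T) (hq : q ∈ T) (hpq : p ≠ q) (f : Poly (n + 1)) :
    cellInt T (fun x => ∑ i, ev (MvPolynomial.pderiv i f) x * (p - q) i)
      = inner ℝ (normal T (T.erase q)) (p - q) * facetInt (T.erase q) (ev f)
        + inner ℝ (normal T (T.erase p)) (p - q) * facetInt (T.erase p) (ev f) := by
  obtain ⟨w, hwq, hwp, hdet⟩ := exists_simplex_enumeration hc hT hp hq hpq
  have hpq' : p ∈ T.erase q := Finset.mem_erase.2 ⟨hpq, hp⟩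
  have hqp' : q ∈ T.erase p := Finset.mem_erase.2 ⟨hpq.symm, hq⟩
  have hwq' : ∀ j, w j ∈ T.erase q := fun j => by
    rw [← Finset.mem_coe, hwq]; exact Set.mem_insert_of_mem _ ⟨j, rfl⟩
  have hwp' : ∀ j, w j ∈ T.erase p := fun j => by
    rw [← Finset.mem_coe, hwp]; exact Set.mem_insert_of_mem _ ⟨j, rfl⟩
  have hTset : (T : Set (Pt (n + 1)))
      = insert q (Set.range (Fin.cons p w : Fin (n + 1) → Pt (n + 1))) := by
    rw [Fin.range_cons, ← hwq, ← Finset.coe_insert, Finset.insert_erase hq]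
  have hframe : (fun j => (Fin.cons p w : Fin (n + 1) → Pt (n + 1)) j - q)
      = Fin.cons (p - q) fun j => w j - q := by
    funext i
    refine Fin.cases ?_ (fun j => ?_) i <;> simp
  have hdet1 : frameDet (Fin.cons (p - q) fun j => w j - p)
      = frameDet (Fin.cons (p - q) fun j => w j - q) := by
    rw [← frameDet_cons_add (p - q) (fun j => w j - q) (-1)]
    congr 2
    funext j
    module
  have hdet2 : frameDet (Fin.cons (q - p) fun j => w j - q)
      = -frameDet (Fin.cons (p - q) fun j => w j - q) := by
    rw [← frameDet_cons_neg, neg_sub]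
  -- Both facet integrals, weighted by their heights, have the factor of the cell integral: the
  -- three frames have the same determinant up to sign.
  obtain ⟨hN1, hpos1⟩ := norm_normal_and_inner_pos hT hq hpq'
  obtain ⟨hN2, hpos2⟩ := norm_normal_and_inner_pos hT hp hqp'
  have e1 := inner_mul_setIntegral_facet hN1
    (fun j => inner_normal_sub_eq_zero T (hwq' j) hpq') hpos1 (by rwa [hdet1]) (ev f)
  have e2 := inner_mul_setIntegral_facet hN2
    (fun j => inner_normal_sub_eq_zero T (hwp' j) hqp') hpos2
    (by rw [hdet2]; exact neg_ne_zero.2 hdet) (ev f)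
  rw [hdet1] at e1
  rw [hdet2, abs_neg] at e2
  rw [← hwq] at e1
  rw [← hwp] at e2
  have e3 := setIntegral_simplex q (Fin.cons p w : Fin (n + 1) → Pt (n + 1))
    (by rw [hframe]; exact hdet) (fun x => ∑ i, ev (MvPolynomial.pderiv i f) x * (p - q) i)
  rw [← hTset, hframe] at e3
  have hsplit : ∀ (s : ℝ) (y : Fin n → ℝ),
      q + ∑ j, (Fin.cons s y : Fin (n + 1) → ℝ) j
          • ((Fin.cons p w : Fin (n + 1) → Pt (n + 1)) j - q)
        = (q + ∑ j, y j • (w j - q)) + s • (p - q) := by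
    intro s y
    rw [Fin.sum_univ_succ]
    simp only [Fin.cons_zero, Fin.cons_succ]
    abel
  -- With `q` as origin and `p` as first vertex, the derivative along `p - q` is the one in the
  -- first coordinate. The lower end of a slice lies on the facet opposite `p`, the upper end on the
  -- facet opposite `q`.
  have e4 := setIntegral_refSimplex_succ
    (g := fun t => ev f (q + ∑ j, t j • ((Fin.cons p w : Fin (n + 1) → Pt (n + 1)) j - q)))
    (g' := fun t => ∑ i, ev (MvPolynomial.pderiv i f)
      (q + ∑ j, t j • ((Fin.cons p w : Fin (n + 1) → Pt (n + 1)) j - q)) * (p - q) i)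
    (continuous_finsetSum _ fun i _ =>
      ((continuous_ev _).comp (by fun_prop)).mul continuous_const)
    (fun y s => by
      simp only [hsplit]
      exact hasDerivAt_ev f _ _ s)
  have hend : ∀ y : Fin n → ℝ, (q + ∑ j, y j • (w j - q)) + (1 - ∑ j, y j) • (p - q)
      = p + ∑ j, y j • (w j - p) := by
    intro y
    simp only [sub_smul, smul_sub, Finset.sum_sub_distrib, Finset.sum_smul, one_smul]
    abel
  simp only [hsplit, hend, zero_smul, add_zero] at e4
  rw [integral_sub] at e4
  · have e2' : inner ℝ (normal T (T.erase p)) (p - q)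
        = -inner ℝ (normal T (T.erase p)) (q - p) := by
      rw [← inner_neg_right, neg_sub]
    simp only [cellInt, facetInt, hull, Nat.add_sub_cancel]
    rw [e3, e4, mul_sub, e2', neg_mul, e1, e2]
    ring
  · exact ((continuous_ev f).comp (by fun_prop)).continuousOn.integrableOn_compact
      (isCompact_refSimplex n)
  · exact ((continuous_ev f).comp (by fun_prop)).continuousOn.integrableOn_compact
      (isCompact_refSimplex n)

/-- Both sides are linear in `u`, and the differences of vertices span. For `u = p - q` the facets
containing both `p` and `q` contribute nothing, their normals being orthogonal to `u`. -/
theorem cellInt_derivative {n : ℕ} [DecidableEq (Pt (n + 1))] {T : Finset (Pt (n + 1))}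
    (hc : T.card = n + 2) (hT : AffineIndependent ℝ ((↑) : T → Pt (n + 1))) (f : Poly (n + 1))
    (u : Pt (n + 1)) :
    cellInt T (fun x => ∑ i, ev (MvPolynomial.pderiv i f) x * u i)
      = ∑ a ∈ T, inner ℝ (normal T (T.erase a)) u * facetInt (T.erase a) (ev f) := by
  have hint : ∀ u : Pt (n + 1), IntegrableOn
      (fun x => ∑ i, ev (MvPolynomial.pderiv i f) x * u i) (hull T) := fun u =>
    integrableOn_hull T (continuous_finsetSum _ fun i _ => (continuous_ev _).mul continuous_const)
  have hspan : vectorSpan ℝ (T : Set (Pt (n + 1))) = ⊤ := by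
    have := hT.vectorSpan_eq_top_of_card_eq_finrank_add_one (by simp [hc])
    have hr : Set.range ((↑) : T → Pt (n + 1)) = (T : Set (Pt (n + 1))) := by ext; simp
    rwa [hr] at this
  have hu : u ∈ vectorSpan ℝ (T : Set (Pt (n + 1))) := by rw [hspan]; trivial
  induction hu using Submodule.span_induction with
  | mem u hu =>
    obtain ⟨p, hp, q, hq, rfl⟩ := hu
    rw [Finset.mem_coe] at hp hq
    simp only [vsub_eq_sub]
    by_cases hpq : p = q
    · subst hpq
      simp [cellInt]
    rw [setIntegral_derivative_edge hc hT hp hq hpq, ← Finset.sum_subset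
      (Finset.insert_subset hq (Finset.singleton_subset_iff.2 hp)), Finset.sum_pair (Ne.symm hpq)]
    intro a ha hna
    simp only [Finset.mem_insert, Finset.mem_singleton, not_or] at hna
    rw [inner_normal_sub_eq_zero T (Finset.mem_erase.2 ⟨Ne.symm hna.2, hp⟩)
      (Finset.mem_erase.2 ⟨Ne.symm hna.1, hq⟩), zero_mul]
  | zero => simp [cellInt]
  | add u v _ _ hu hv =>
    simp only [PiLp.add_apply, mul_add, Finset.sum_add_distrib, inner_add_right, add_mul]
    rw [← hu, ← hv]
    exact integral_add (hint u) (hint v)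
  | smul c u _ hu =>
    simp only [PiLp.smul_apply, smul_eq_mul, mul_left_comm _ c, ← Finset.mul_sum, inner_smul_right,
      mul_assoc]
    rw [← hu]
    exact integral_const_mul c _

/-- The divergence theorem on a simplex, for one partial derivative. -/
theorem cellInt_pderiv {n : ℕ} {T : Finset (Pt (n + 1))}
    (hc : T.card = n + 2) (hT : AffineIndependent ℝ ((↑) : T → Pt (n + 1))) (f : Poly (n + 1))
    (i : Fin (n + 1)) :
    cellInt T (ev (MvPolynomial.pderiv i f))
      = ∑ e ∈ facets T, nrm T e i * facetInt e (ev f) := by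
  classical
  have h := cellInt_derivative hc hT f (EuclideanSpace.single i 1)
  rw [sum_facets hc (fun e => nrm T e i * facetInt e (ev f))]
  simpa [nrm, EuclideanSpace.inner_single_right, Pi.single_apply] using h

/-! ### Facets shared by two elements -/

theorem vectorSpan_cell_eq_top {d : ℕ} {T : Finset (Pt d)} (hc : T.card = d + 1)
    (hT : AffineIndependent ℝ ((↑) : T → Pt d)) : vectorSpan ℝ (T : Set (Pt d)) = ⊤ := by
  have := hT.vectorSpan_eq_top_of_card_eq_finrank_add_one (by simp [hc])
  have hr : Set.range ((↑) : T → Pt d) = (T : Set (Pt d)) := by ext; simp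
  rwa [hr] at this

theorem exists_eq_erase_of_mem_facets {d : ℕ} [DecidableEq (Pt d)] {T e : Finset (Pt d)}
    (hc : T.card = d + 1) (he : e ∈ facets T) : ∃ a ∈ T, e = T.erase a := by
  rw [facets_eq_image_erase hc, Finset.mem_image] at he
  obtain ⟨a, ha, rfl⟩ := he
  exact ⟨a, ha, rfl⟩

theorem inner_normal_sub_eq_zero_of_mem_hull {d : ℕ} (T : Finset (Pt d)) {e : Finset (Pt d)}
    {p x : Pt d} (hp : p ∈ e) (hx : x ∈ hull e) : inner ℝ (normal T e) (x - p) = 0 := by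
  have : hull e ⊆ {x | inner ℝ (normal T e) x = inner ℝ (normal T e) p} := by
    refine convexHull_min ?_ ?_
    · intro y hy
      have := inner_normal_sub_eq_zero T (Finset.mem_coe.1 hy) hp
      rw [inner_sub_right, sub_eq_zero] at this
      exact this
    · exact convex_hyperplane (f := fun x => inner ℝ (normal T e) x)
        ((innerₛₗ ℝ (normal T e)).isLinear) _
  rw [inner_sub_right, sub_eq_zero]
  exact this hx

/-- A point on the inner side of a face of a simplex sees an interior point of this face within the
simplex. -/
theorem exists_lineMap_mem_convexHull {d : ℕ} {ι : Type*} [Fintype ι] [DecidableEq ι]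
    (b : AffineBasis ι ℝ (Pt d)) (i₀ : ι) (hne : (Finset.univ.erase i₀).Nonempty) {a : Pt d}
    (ha : 0 ≤ b.coord i₀ a) :
    ∃ c ∈ convexHull ℝ (b '' {i | i ≠ i₀}), ∃ s : ℝ, 0 < s ∧ s < 1 ∧
      AffineMap.lineMap c a s ∈ convexHull ℝ (Set.range b) := by
  -- The point `c` is the centroid of the face. Its other coordinates are positive and stay so
  -- nearby; the coordinate `i₀` is zero at `c` and `s` times that of `a` on the segment.
  set S : Finset ι := Finset.univ.erase i₀ with hS
  have hw := S.sum_centroidWeights_eq_one_of_nonempty ℝ hne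
  obtain ⟨c, hcdef⟩ : ∃ c, c = S.centroid ℝ b := ⟨_, rfl⟩
  have hcpos : ∀ i, i ≠ i₀ → 0 < b.coord i c := by
    intro i hi
    rw [hcdef, b.coord_apply_centroid (Finset.mem_erase.2 ⟨hi, Finset.mem_univ _⟩)]
    have := hne.card_pos
    positivity
  have hc0 : b.coord i₀ c = 0 := by
    rw [hcdef, Finset.centroid_def, b.coord_apply_combination_of_notMem (by simp [hS]) hw]
  have hcont : ∀ i, Continuous fun s : ℝ => b.coord i (AffineMap.lineMap c a s) := fun i =>
    (b.coord i).continuous_of_finiteDimensional.comp AffineMap.lineMap_continuous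
  have hev : ∀ᶠ s : ℝ in 𝓝[>] 0, ∀ i, i ≠ i₀ → 0 < b.coord i (AffineMap.lineMap c a s) := by
    rw [eventually_all]
    intro i
    by_cases hi : i = i₀
    · exact Eventually.of_forall fun s h => absurd hi h
    · have := (hcont i).tendsto 0
      rw [AffineMap.lineMap_apply_zero] at this
      filter_upwards [nhdsWithin_le_nhds (this.eventually_const_lt (hcpos i hi))] with s hs _
        using hs
  have hev1 : ∀ᶠ s : ℝ in 𝓝[>] 0, s < 1 := nhdsWithin_le_nhds (eventually_lt_nhds one_pos)
  obtain ⟨s, hs1, hs2, hs0⟩ := (hev.and (hev1.and self_mem_nhdsWithin)).exists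
  have hs0 : 0 < s := hs0
  refine ⟨c, ?_, s, hs0, hs2, ?_⟩
  · rw [hcdef, Finset.centroid_def, Finset.affineCombination_eq_linear_combination _ _ _ hw]
    refine (convex_convexHull ℝ _).sum_mem (fun i _ => by simp) hw fun i hi => ?_
    exact subset_convexHull ℝ _ ⟨i, (Finset.mem_erase.1 hi).1, rfl⟩
  · rw [b.convexHull_eq_nonneg_coord]
    intro i
    by_cases hi : i = i₀
    · rw [hi, AffineMap.apply_lineMap, hc0, AffineMap.lineMap_apply_module]
      simp only [smul_eq_mul, mul_zero, zero_add]
      positivity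
    · exact (hs1 i hi).le

section Opposite

variable {d : ℕ} [DecidableEq (Pt d)] {T T' : Finset (Pt d)} {a a' : Pt d}

/-- If two simplices meet in a common facet only, they lie on opposite sides of it. -/
theorem inner_normal_pos_of_inter_subset (hc' : T'.card = d + 1)
    (hT : AffineIndependent ℝ ((↑) : T → Pt d)) (hT' : AffineIndependent ℝ ((↑) : T' → Pt d))
    (ha : a ∈ T) (ha' : a' ∈ T') (he : T.erase a = T'.erase a')
    (hconf : hull T ∩ hull T' ⊆ hull (T.erase a)) {p : Pt d} (hp : p ∈ T.erase a) :
    0 < inner ℝ (normal T' (T.erase a)) (a - p) := by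
  have hp' : p ∈ T'.erase a' := he ▸ hp
  obtain ⟨hN, hpos⟩ := norm_normal_and_inner_pos hT ha hp
  obtain ⟨hN', hpos'⟩ := norm_normal_and_inner_pos hT' ha' hp'
  rw [← he] at hN' hpos'
  have hrange : Set.range ((↑) : T' → Pt d) = (T' : Set (Pt d)) := by ext; simp
  obtain ⟨b, hb⟩ : ∃ b : AffineBasis T' ℝ (Pt d), ⇑b = ((↑) : T' → Pt d) :=
    ⟨⟨(↑), hT', hT'.affineSpan_eq_top_iff_card_eq_finrank_add_one.2 (by simp [hc'])⟩, rfl⟩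
  have hmem : ∀ i : T', i ≠ ⟨a', ha'⟩ → (i : Pt d) ∈ T.erase a := by
    intro i hi
    rw [he]
    exact Finset.mem_erase.2 ⟨fun h => hi (Subtype.ext h), i.2⟩
  -- Otherwise a segment from a point `c` of the facet to `a` would contain a point `c + s (a - c)`,
  -- `s > 0`, of both simplices. By conformity it would lie in the facet, but its distance from the
  -- facet plane is positive.
  have hneg : b.coord ⟨a', ha'⟩ a < 0 := by
    by_contra! hnn
    obtain ⟨c, hcF, s, hs0, hs1, hs⟩ := exists_lineMap_mem_convexHull b ⟨a', ha'⟩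
      ⟨⟨p, Finset.mem_of_mem_erase hp'⟩, Finset.mem_erase.2
        ⟨fun h => (Finset.mem_erase.1 hp').1 (congrArg Subtype.val h), Finset.mem_univ _⟩⟩ hnn
    have hce : c ∈ hull (T.erase a) := by
      refine convexHull_mono ?_ hcF
      rintro _ ⟨i, hi, rfl⟩
      rw [hb]
      exact hmem i hi
    have hxT : AffineMap.lineMap c a s ∈ hull T :=
      (convex_convexHull ℝ (T : Set (Pt d))).lineMap_mem
        (convexHull_mono (Finset.coe_subset.2 (Finset.erase_subset a T)) hce)
        (subset_convexHull ℝ _ ha) ⟨hs0.le, hs1.le⟩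
    have hxT' : AffineMap.lineMap c a s ∈ hull T' := by
      rw [hb, hrange] at hs
      exact hs
    have hxe := inner_normal_sub_eq_zero_of_mem_hull T hp (hconf ⟨hxT, hxT'⟩)
    have hce0 := inner_normal_sub_eq_zero_of_mem_hull T hp hce
    rw [AffineMap.lineMap_apply_module,
      show (1 - s) • c + s • a - p = (1 - s) • (c - p) - s • (p - a) by module,
      inner_sub_right, inner_smul_right, inner_smul_right, hce0, mul_zero, zero_sub,
      neg_eq_zero] at hxe
    exact (mul_pos hs0 hpos).ne' hxe
  -- All vertices but `a'` lie in the facet, so the normal sees only the term of `a'`, a product of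
  -- two negative numbers.
  have hsum : a - p = ∑ i, b.coord i a • (b i - p) := by
    simp only [smul_sub, Finset.sum_sub_distrib, ← Finset.sum_smul, b.sum_coord_apply_eq_one,
      b.linear_combination_coord_eq_self, one_smul]
  rw [hsum, inner_sum, Finset.sum_eq_single ⟨a', ha'⟩]
  · rw [inner_smul_right, hb, ← neg_sub p, inner_neg_right]
    nlinarith
  · intro i _ hi
    rw [inner_smul_right, hb, inner_normal_sub_eq_zero T' (hmem i hi) hp, mul_zero]
  · simp

theorem normal_eq_neg_of_inter_subset (hd : 0 < d) (hc : T.card = d + 1) (hc' : T'.card = d + 1)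
    (hT : AffineIndependent ℝ ((↑) : T → Pt d)) (hT' : AffineIndependent ℝ ((↑) : T' → Pt d))
    (ha : a ∈ T) (ha' : a' ∈ T') (he : T.erase a = T'.erase a')
    (hconf : hull T ∩ hull T' ⊆ hull (T.erase a)) :
    normal T' (T.erase a) = -normal T (T.erase a) := by
  have hecard : (T.erase a).card = d := by rw [Finset.card_erase_of_mem ha]; omega
  obtain ⟨p, hp⟩ : (T.erase a).Nonempty := Finset.card_pos.1 (by omega)
  have hopp := inner_normal_pos_of_inter_subset hc' hT hT' ha ha' he hconf hp
  obtain ⟨hN, hpos⟩ := norm_normal_and_inner_pos hT ha hp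
  obtain ⟨hN', -⟩ := norm_normal_and_inner_pos hT' ha' (he ▸ hp)
  rw [← he] at hN'
  set N := normal T (T.erase a) with hNdef
  set N' := normal T' (T.erase a) with hNdef'
  rw [← neg_sub p, inner_neg_right] at hopp
  -- This ratio makes `N' - μ N` orthogonal to `a - p`. It is orthogonal to the facet anyway, hence
  -- zero; as both vectors are unit and `μ < 0`, `μ = -1`.
  set μ := inner ℝ N' (p - a) / inner ℝ N (p - a) with hμ
  have hμneg : μ < 0 := div_neg_of_neg_of_pos (by linarith) hpos
  have hN'eq : N' = μ • N := by
    rw [← sub_eq_zero, ← inner_self_eq_zero (𝕜 := ℝ)]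
    have hall : ∀ y ∈ vectorSpan ℝ (T : Set (Pt d)), inner ℝ (N' - μ • N) y = 0 := by
      intro y hy
      rw [vectorSpan_eq_span_vsub_set_right ℝ (Finset.mem_coe.2 (Finset.mem_of_mem_erase hp))] at hy
      induction hy using Submodule.span_induction with
      | mem y hy =>
        obtain ⟨v, hv, rfl⟩ := hy
        rw [Finset.mem_coe] at hv
        simp only [vsub_eq_sub]
        rw [inner_sub_left, inner_smul_left]
        by_cases hva : v = a
        · subst hva
          rw [← neg_sub p, inner_neg_right, inner_neg_right, hμ]
          simp only [conj_trivial]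
          field_simp
          ring
        · have hv' := Finset.mem_erase.2 ⟨hva, hv⟩
          rw [hNdef, hNdef', inner_normal_sub_eq_zero T' hv' hp, inner_normal_sub_eq_zero T hv' hp]
          simp
      | zero => simp
      | add u v _ _ hu hv => rw [inner_add_right, hu, hv, add_zero]
      | smul c u _ hu => rw [inner_smul_right, hu, mul_zero]
    exact hall _ (by rw [vectorSpan_cell_eq_top hc hT]; trivial)
  have hμ1 : |μ| = 1 := by
    have := congrArg norm hN'eq
    rw [norm_smul, hN, hN', mul_one, Real.norm_eq_abs] at this
    exact this.symm
  rw [abs_of_neg hμneg] at hμ1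
  rw [hN'eq, show μ = -1 by linarith, neg_one_smul]

end Opposite

/-! ### Neighbours across a facet and cancellation over the skeleton -/

namespace Triangulation

variable {d : ℕ} {Ω : Set (Pt d)} (M : Triangulation Ω)

theorem normal_eq_neg (hd : 0 < d) {T T' e : Finset (Pt d)} (hT : T ∈ M.cells) (hT' : T' ∈ M.cells)
    (hne : T ≠ T') (he : e ∈ facets T) (he' : e ∈ facets T') : normal T' e = -normal T e := by
  classical
  obtain ⟨a, ha, rfl⟩ := exists_eq_erase_of_mem_facets (M.card_cell T hT) he
  obtain ⟨a', ha', hea⟩ := exists_eq_erase_of_mem_facets (M.card_cell T' hT') he'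
  refine normal_eq_neg_of_inter_subset hd (M.card_cell T hT) (M.card_cell T' hT') (M.indep T hT)
    (M.indep T' hT') ha ha' hea ((M.conforming T hT T' hT').trans (convexHull_mono ?_))
  -- A common vertex outside the facet would be opposite to it in both elements, which would then
  -- coincide.
  rintro x ⟨hx, hx'⟩
  rw [Finset.mem_coe] at hx hx' ⊢
  refine Finset.mem_erase.2 ⟨fun hxa => hne ?_, hx⟩
  subst hxa
  have : x = a' := by
    by_contra h
    have h2 : x ∈ T'.erase a' := Finset.mem_erase.2 ⟨h, hx'⟩
    rw [← hea] at h2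
    simp at h2
  rw [← Finset.insert_erase ha, hea, this, Finset.insert_erase ha']

theorem norm_normal_eq_one (hd : 0 < d) {T e : Finset (Pt d)} (hT : T ∈ M.cells)
    (he : e ∈ facets T) : ‖normal T e‖ = 1 := by
  classical
  obtain ⟨a, ha, rfl⟩ := exists_eq_erase_of_mem_facets (M.card_cell T hT) he
  have hecard : (T.erase a).card = d := by
    rw [Finset.card_erase_of_mem ha, M.card_cell T hT]; omega
  obtain ⟨p, hp⟩ : (T.erase a).Nonempty := Finset.card_pos.1 (by omega)
  exact (norm_normal_and_inner_pos (M.indep T hT) ha hp).1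

/-- A facet belongs to at most two elements. -/
theorem eq_of_mem_facets (hd : 0 < d) {T T₁ T₂ e : Finset (Pt d)} (hT : T ∈ M.cells)
    (hT₁ : T₁ ∈ M.cells) (hT₂ : T₂ ∈ M.cells) (h₁ : T₁ ≠ T) (h₂ : T₂ ≠ T) (he : e ∈ facets T)
    (he₁ : e ∈ facets T₁) (he₂ : e ∈ facets T₂) : T₁ = T₂ := by
  -- Three distinct elements at one facet would have pairwise opposite normals, forcing a unit
  -- vector to be zero.
  by_contra h
  have e1 := M.normal_eq_neg hd hT hT₁ h₁.symm he he₁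
  have e2 := M.normal_eq_neg hd hT hT₂ h₂.symm he he₂
  have e3 := M.normal_eq_neg hd hT₁ hT₂ h he₁ he₂
  rw [e1, e2, neg_neg] at e3
  have h0 : normal T e = 0 := by
    have h2 : (2 : ℝ) • normal T e = 0 := by
      rw [two_smul]
      nth_rewrite 1 [← e3]
      exact neg_add_cancel _
    simpa using h2
  have := M.norm_normal_eq_one hd hT he
  rw [h0, norm_zero] at this
  exact zero_ne_one this

theorem opp_of_isBoundary {T e : Finset (Pt d)} (h : M.IsBoundary T e) : M.opp T e = T := dif_neg h

theorem opp_spec {T e : Finset (Pt d)} (he : e ∈ facets T) (h : M.IsInternal T e) :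
    M.opp T e ∈ M.cells ∧ M.opp T e ≠ T ∧ e ∈ facets (M.opp T e) := by
  have hopp : M.opp T e = h.choose := dif_pos h
  obtain ⟨h1, h2, h3⟩ := h.choose_spec
  rw [hopp]
  exact ⟨h1, h2, Finset.mem_powersetCard.2 ⟨h3, (Finset.mem_powersetCard.1 he).2⟩⟩

theorem opp_mem {T e : Finset (Pt d)} (hT : T ∈ M.cells) (he : e ∈ facets T) :
    M.opp T e ∈ M.cells := by
  by_cases h : M.IsInternal T e
  · exact (M.opp_spec he h).1
  · rwa [M.opp_of_isBoundary h]

theorem isInternal_opp {T e : Finset (Pt d)} (hT : T ∈ M.cells) (he : e ∈ facets T)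
    (h : M.IsInternal T e) : M.IsInternal (M.opp T e) e :=
  ⟨T, hT, (M.opp_spec he h).2.1.symm, (Finset.mem_powersetCard.1 he).1⟩

/-- `opp` is defined by choice; uniqueness of the neighbour makes it an involution. -/
theorem opp_opp (hd : 0 < d) {T e : Finset (Pt d)} (hT : T ∈ M.cells) (he : e ∈ facets T)
    (h : M.IsInternal T e) : M.opp (M.opp T e) e = T := by
  obtain ⟨h1, h2, h3⟩ := M.opp_spec he h
  obtain ⟨h1', h2', h3'⟩ := M.opp_spec h3 (M.isInternal_opp hT he h)
  exact M.eq_of_mem_facets hd h1 h1' hT h2' h2.symm h3 h3' he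

theorem nrm_opp (hd : 0 < d) {T e : Finset (Pt d)} (hT : T ∈ M.cells) (he : e ∈ facets T)
    (h : M.IsInternal T e) : nrm (M.opp T e) e = -nrm T e := by
  obtain ⟨h1, h2, h3⟩ := M.opp_spec he h
  funext i
  simp [nrm, M.normal_eq_neg hd hT h1 h2.symm he h3]

/-- A skeleton integral vanishes if the contributions from the two sides of each internal facet
cancel and those from boundary facets vanish. -/
theorem skelInt_eq_zero (hd : 0 < d) (F : Finset (Pt d) → Finset (Pt d) → Pt d → ℝ)
    (hint : ∀ T ∈ M.cells, ∀ e ∈ facets T, M.IsInternal T e → ∀ x ∈ hull e,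
      F (M.opp T e) e x = -F T e x)
    (hbd : ∀ T ∈ M.cells, ∀ e ∈ facets T, M.IsBoundary T e → ∀ x ∈ hull e, F T e x = 0) :
    M.skelInt F = 0 := by
  have hbd' : ∀ T ∈ M.cells, ∀ e ∈ facets T, M.IsBoundary T e → facetInt e (F T e) = 0 :=
    fun T hT e he h => setIntegral_eq_zero_of_forall_eq_zero (hbd T hT e he h)
  have hint' : ∀ T ∈ M.cells, ∀ e ∈ facets T, M.IsInternal T e →
      facetInt e (F T e) + facetInt e (F (M.opp T e) e) = 0 := by
    intro T hT e he h
    have : facetInt e (F (M.opp T e) e) = ∫ x in hull e, -F T e x ∂μHE[d - 1] :=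
      setIntegral_congr_fun (measurableSet_hull e) (hint T hT e he h)
    rw [this, integral_neg]
    exact add_neg_cancel _
  rw [skelInt, Finset.sum_sigma']
  -- A facet seen from `T` is paired with the same facet seen from the neighbour. The fixed points
  -- are the boundary facets, whose terms vanish.
  refine Finset.sum_involution (fun a _ => ⟨M.opp a.1 a.2, a.2⟩) ?_ ?_ ?_ ?_
  · rintro ⟨T, e⟩ ha
    obtain ⟨hT, he⟩ := Finset.mem_sigma.1 ha
    by_cases h : M.IsInternal T e
    · exact hint' T hT e he h
    · simp only [M.opp_of_isBoundary h, hbd' T hT e he h, add_zero]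
  · rintro ⟨T, e⟩ ha hne heq
    obtain ⟨hT, he⟩ := Finset.mem_sigma.1 ha
    by_cases h : M.IsInternal T e
    · exact (M.opp_spec he h).2.1 (congrArg Sigma.fst heq)
    · exact hne (hbd' T hT e he h)
  · rintro ⟨T, e⟩ ha
    obtain ⟨hT, he⟩ := Finset.mem_sigma.1 ha
    by_cases h : M.IsInternal T e
    · exact Finset.mem_sigma.2 ⟨(M.opp_spec he h).1, (M.opp_spec he h).2.2⟩
    · simpa only [M.opp_of_isBoundary h] using ha
  · rintro ⟨T, e⟩ ha
    obtain ⟨hT, he⟩ := Finset.mem_sigma.1 ha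
    by_cases h : M.IsInternal T e
    · simp only [M.opp_opp hd hT he h]
    · simp only [M.opp_of_isBoundary h]

end Triangulation

/-! ### Convergence of linear functionals of polynomials of bounded degree -/

theorem eq_zero_of_forall_mem_open {d : ℕ} {p : Poly d} {U : Set (Pt d)} (hU : IsOpen U)
    (hne : U.Nonempty) (h : ∀ x ∈ U, ev p x = 0) : p = 0 := by
  obtain ⟨x, hx⟩ := hne
  have hU' : IsOpen ((WithLp.toLp 2 : (Fin d → ℝ) → Pt d) ⁻¹' U) :=
    hU.preimage (PiLp.continuous_toLp 2 _)
  obtain ⟨δ, hδ, hball⟩ := Metric.isOpen_iff.1 hU' (fun i => x i) hx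
  refine MvPolynomial.funext_set (fun i => Metric.ball (x i) δ) (fun i => ?_) fun y hy => ?_
  · rw [Real.ball_eq_Ioo]
    exact Set.Ioo_infinite (by linarith)
  · rw [← ball_pi _ hδ] at hy
    simpa [ev] using h _ (hball hy)

section Functional

variable {d : ℕ} {T : Finset (Pt d)}

/-- Integration over an element as a linear functional on polynomials. -/
def cellIntₗ (T : Finset (Pt d)) : Poly d →ₗ[ℝ] ℝ where
  toFun p := cellInt T (ev p)
  map_add' p q := by
    simp only [cellInt, ev_add]
    exact integral_add (integrableOn_hull T (continuous_ev p)) (integrableOn_hull T (continuous_ev q))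
  map_smul' a p := by
    simp only [cellInt, ev_smul]
    exact integral_const_mul a _

theorem cellIntₗ_apply (T : Finset (Pt d)) (p : Poly d) : cellIntₗ T p = cellInt T (ev p) := rfl

theorem interior_hull_nonempty (hc : T.card = d + 1)
    (hT : AffineIndependent ℝ ((↑) : T → Pt d)) : (interior (hull T)).Nonempty := by
  have hr : Set.range ((↑) : T → Pt d) = (T : Set (Pt d)) := by ext; simp
  rw [hull, interior_convexHull_nonempty_iff_affineSpan_eq_top, ← hr]
  exact hT.affineSpan_eq_top_iff_card_eq_finrank_add_one.2 (by simp [hc])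

theorem eq_zero_of_cellInt_sq_eq_zero (hc : T.card = d + 1)
    (hT : AffineIndependent ℝ ((↑) : T → Pt d)) {p : Poly d} (h : cellInt T (ev (p * p)) = 0) :
    p = 0 := by
  have h0 := (integral_eq_zero_iff_of_nonneg (f := ev (p * p))
    (fun x => by rw [ev_mul]; exact mul_self_nonneg _)
    (integrableOn_hull T (continuous_ev _))).1 h
  have h1 := ae_restrict_of_ae_restrict_of_subset (interior_subset (s := hull T)) h0
  have h2 := Measure.eqOn_open_of_ae_eq h1 isOpen_interior (continuous_ev _).continuousOn
    continuous_const.continuousOn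
  refine eq_zero_of_forall_mem_open isOpen_interior (interior_hull_nonempty hc hT) fun x hx => ?_
  have := h2 hx
  simpa using this

/-- On polynomials of degree at most `k` the `L²(T)` product is an inner product on a
finite-dimensional space, so every functional, including those that differentiate, is
`L²`-continuous. -/
theorem tendsto_of_cellInt_sq_tendsto_zero (hc : T.card = d + 1)
    (hT : AffineIndependent ℝ ((↑) : T → Pt d)) {k : ℕ} {f : ℕ → Poly d} {g : Poly d}
    (hf : ∀ l, (f l).totalDegree ≤ k) (hg : g.totalDegree ≤ k)
    (h : Tendsto (fun l => cellInt T fun x => (ev (f l) x - ev g x) ^ 2) atTop (𝓝 0))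
    (Λ : Poly d →ₗ[ℝ] ℝ) : Tendsto (fun l => Λ (f l)) atTop (𝓝 (Λ g)) := by
  set V := MvPolynomial.restrictTotalDegree (Fin d) ℝ k with hV
  let B : LinearMap.BilinForm ℝ V :=
    ((LinearMap.mul ℝ (Poly d)).compr₂ (cellIntₗ T)).compl₁₂ V.subtype V.subtype
  have hB : ∀ p q : V, B p q = cellInt T (ev (p.1 * q.1)) := fun p q => rfl
  have hsymm : LinearMap.IsSymm B := ⟨fun p q => by simp [hB, mul_comm]⟩
  have hnn : ∀ p, 0 ≤ B p p := fun p => by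
    rw [hB]
    exact integral_nonneg fun x => by rw [ev_mul]; exact mul_self_nonneg _
  have hdef : ∀ p, B p p = 0 → p = 0 := fun p hp =>
    Subtype.ext (eq_zero_of_cellInt_sq_eq_zero hc hT hp)
  have hnd : B.Nondegenerate :=
    ⟨fun p hp => hdef p (hp p), fun p hp => hdef p (hp p)⟩
  -- The Riesz representative of `Λ`; Cauchy-Schwarz then bounds the error of `Λ`.
  set q := (B.toDual hnd).symm (Λ ∘ₗ V.subtype) with hq
  have hrep : ∀ p : V, B q p = Λ p := fun p => LinearMap.BilinForm.apply_toDual_symm_apply _ _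
  have hmem : ∀ l, f l - g ∈ V := fun l => V.sub_mem
    ((MvPolynomial.mem_restrictTotalDegree _ _ _).2 (hf l))
    ((MvPolynomial.mem_restrictTotalDegree _ _ _).2 hg)
  have hsq : Tendsto (fun l => (Λ (f l) - Λ g) ^ 2) atTop (𝓝 0) := by
    refine squeeze_zero (fun l => sq_nonneg _) (fun l => ?_) (by simpa using h.const_mul (B q q))
    have := B.apply_sq_le_of_symm hnn hsymm q ⟨f l - g, hmem l⟩
    rw [hrep, map_sub] at this
    refine this.trans (le_of_eq ?_)
    rw [hB ⟨f l - g, hmem l⟩, show ev ((f l - g) * (f l - g)) = fun x => (ev (f l) x - ev g x) ^ 2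
      from funext fun x => by simp [sq]]
  have habs : Tendsto (fun l => |Λ (f l) - Λ g|) atTop (𝓝 0) := by
    have := (Real.continuous_sqrt.tendsto 0).comp hsq
    simpa [Function.comp_def, Real.sqrt_sq_eq_abs] using this
  have := (tendsto_zero_iff_abs_tendsto_zero _).2 habs
  simpa using this.add_const (Λ g)

end Functional

/-! ### Facet integrals -/

/-- The hull is a Lipschitz image of the compact reference simplex of dimension `n`. -/
theorem euclideanHausdorffMeasure_hull_lt_top {d n : ℕ} {e : Finset (Pt d)} (he : e.card = n + 1) :
    μHE[n] (hull e) < ⊤ := by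
  classical
  obtain ⟨p, hp⟩ : e.Nonempty := Finset.card_pos.1 (by omega)
  have hcS : (e.erase p).card = n := by rw [Finset.card_erase_of_mem hp]; omega
  set w : Fin n → Pt d := fun j => ((e.erase p).equivFinOfCardEq hcS).symm j with hw
  have hrange : Set.range w = ((e.erase p : Finset (Pt d)) : Set (Pt d)) := by
    ext x
    constructor
    · rintro ⟨j, rfl⟩; exact (((e.erase p).equivFinOfCardEq hcS).symm j).2
    · intro hx
      exact ⟨(e.erase p).equivFinOfCardEq hcS ⟨x, hx⟩, by simp [hw]⟩
  have heset : (e : Set (Pt d)) = insert p (Set.range w) := by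
    rw [hrange, ← Finset.coe_insert, Finset.insert_erase hp]
  let φ : EuclideanSpace ℝ (Fin n) →L[ℝ] Pt d :=
    ∑ j, (EuclideanSpace.proj j).smulRight (w j - p)
  have himg : hull e = (fun y => p + φ y) '' (WithLp.toLp 2 '' refSimplex n) := by
    rw [hull, heset, convexHull_insert_range_eq_image, Set.image_image]
    simp [φ]
  have hK : IsCompact (WithLp.toLp 2 '' refSimplex n : Set (EuclideanSpace ℝ (Fin n))) :=
    (isCompact_refSimplex n).image (PiLp.continuous_toLp 2 _)
  have hlip : LipschitzWith ‖φ‖₊ fun y => p + φ y := by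
    refine LipschitzWith.of_dist_le_mul fun x y => ?_
    rw [dist_add_left]
    exact φ.lipschitz.dist_le_mul x y
  have hle := hlip.hausdorffMeasure_image_le (d := n) (by positivity)
    (WithLp.toLp 2 '' refSimplex n : Set (EuclideanSpace ℝ (Fin n)))
  rw [← himg] at hle
  rw [Measure.euclideanHausdorffMeasure_def, Measure.smul_apply, ENNReal.smul_def, smul_eq_mul]
  refine ENNReal.mul_lt_top ENNReal.coe_lt_top (hle.trans_lt (ENNReal.mul_lt_top ?_ hK.measure_lt_top))
  exact ENNReal.rpow_lt_top_of_nonneg (by positivity) ENNReal.coe_ne_top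

theorem integrableOn_facet {d : ℕ} (hd : 0 < d) {T e : Finset (Pt d)} (he : e ∈ facets T)
    {f : Pt d → ℝ} (hf : Continuous f) : IntegrableOn f (hull e) μHE[d - 1] := by
  have hc : e.card = (d - 1) + 1 := by rw [(Finset.mem_powersetCard.1 he).2]; omega
  exact hf.continuousOn.integrableOn_of_subset_isCompact (isCompact_hull e) (measurableSet_hull e)
    subset_rfl (euclideanHausdorffMeasure_hull_lt_top hc).ne

/-- The divergence theorem on a simplex. -/
theorem cellInt_divP {d : ℕ} (hd : 0 < d) {T : Finset (Pt d)} (hc : T.card = d + 1)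
    (hT : AffineIndependent ℝ ((↑) : T → Pt d)) (v : Fin d → Poly d) :
    cellInt T (ev (divP v)) = ∑ e ∈ facets T, facetInt e fun x => evV v x ⬝ᵥ nrm T e := by
  obtain ⟨n, rfl⟩ := Nat.exists_eq_succ_of_ne_zero hd.ne'
  have h1 : cellInt T (ev (divP v)) = ∑ i, cellInt T (ev (MvPolynomial.pderiv i (v i))) := by
    simp only [← cellIntₗ_apply, divP, map_sum]
  have h2 : ∀ e ∈ facets T, facetInt e (fun x => evV v x ⬝ᵥ nrm T e)
      = ∑ i, nrm T e i * facetInt e (ev (v i)) := by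
    intro e he
    simp only [facetInt, dotProduct, evV]
    rw [integral_finsetSum]
    · refine Finset.sum_congr rfl fun i _ => ?_
      rw [integral_mul_const, mul_comm]
    · intro i _
      exact (integrableOn_facet hd he (continuous_ev (v i))).mul_const _
  rw [h1, Finset.sum_congr rfl h2, Finset.sum_comm]
  exact Finset.sum_congr rfl fun i _ => cellInt_pderiv hc hT (v i) i

/-! ### Curl and constant fields -/

/-- Each component of the curl is the divergence of a row of a skew array built from `w`, so the
divergence theorem yields boundary values of `n × w` only. -/
theorem exists_divP_eq_curlP {d : ℕ} (hd : d = 2 ∨ d = 3) (w : Fin (vdim d) → Poly d) (i : Fin d) :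
    ∃ F : Fin d → Poly d, divP F = curlP d w i ∧
      ∀ (n : Fin d → ℝ) (x : Pt d), evV F x ⬝ᵥ n = crossVort d n (evV w x) i := by
  rcases hd with rfl | rfl
  · fin_cases i
    · exact ⟨![0, w (0 : Fin 1)], by simp [divP, curlP, Fin.sum_univ_two],
        fun n x => by simp [evV, crossVort, dotProduct, Fin.sum_univ_two, mul_comm]⟩
    · exact ⟨![-w (0 : Fin 1), 0], by simp [divP, curlP, Fin.sum_univ_two],
        fun n x => by simp [evV, crossVort, dotProduct, Fin.sum_univ_two, mul_comm]⟩
  · fin_cases i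
    · exact ⟨![0, w (2 : Fin 3), -w (1 : Fin 3)],
        by simp [divP, curlP, Fin.sum_univ_three, sub_eq_add_neg],
        fun n x => by simp [evV, crossVort, dotProduct, Fin.sum_univ_three]; ring⟩
    · exact ⟨![-w (2 : Fin 3), 0, w (0 : Fin 3)],
        by simp [divP, curlP, Fin.sum_univ_three, sub_eq_add_neg, add_comm],
        fun n x => by simp [evV, crossVort, dotProduct, Fin.sum_univ_three]; ring⟩
    · exact ⟨![w (1 : Fin 3), -w (0 : Fin 3), 0],
        by simp [divP, curlP, Fin.sum_univ_three, sub_eq_add_neg],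
        fun n x => by simp [evV, crossVort, dotProduct, Fin.sum_univ_three]; ring⟩

theorem crossVort_neg {d : ℕ} (hd : d = 2 ∨ d = 3) (n : Fin d → ℝ) (w : Fin (vdim d) → ℝ) :
    crossVort d (-n) w = -crossVort d n w := by
  rcases hd with rfl | rfl
  · funext i
    fin_cases i <;> simp [crossVort]
  · funext i
    fin_cases i <;> simp [crossVort] <;> ring

/-- The field that is constantly the `i`-th coordinate vector. -/
def constField {d : ℕ} (i : Fin d) : VectorField d d := fun _ => Pi.single i 1

theorem evV_constField {d : ℕ} (i : Fin d) (T : Finset (Pt d)) (x : Pt d) :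
    evV (constField i T) x = Pi.single i 1 := by
  funext j
  by_cases h : j = i
  · subst h; simp [evV, constField]
  · simp [evV, constField, h]

theorem ev_constField {d : ℕ} (i j : Fin d) (T : Finset (Pt d)) (x : Pt d) :
    ev (constField i T j) x = (Pi.single i 1 : Fin d → ℝ) j :=
  congrFun (evV_constField i T x) j

theorem pderiv_constField {d : ℕ} (i j k : Fin d) (T : Finset (Pt d)) :
    MvPolynomial.pderiv k (constField i T j) = 0 := by
  by_cases h : j = i
  · subst h; simp [constField]
  · simp [constField, h]

theorem divP_constField {d : ℕ} (i : Fin d) (T : Finset (Pt d)) : divP (constField i T) = 0 :=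
  Finset.sum_eq_zero fun j _ => pderiv_constField i j j T

theorem totalDegree_le_of_isLocalSigma {d r : ℕ} (hd : d = 2 ∨ d = 3) {w : Fin (vdim d) → Poly d}
    (hw : IsLocalSigma d r w) (k : Fin (vdim d)) : (w k).totalDegree ≤ r + 1 := by
  rcases hd with rfl | rfl
  · have : k = (0 : Fin 1) := Subsingleton.elim (α := Fin 1) _ _
    rw [this]
    exact hw
  · obtain ⟨a, b, ha, hb, -, rfl⟩ := hw
    exact (MvPolynomial.totalDegree_add _ _).trans
      (max_le ((ha k).trans (Nat.le_succ r)) (hb k).totalDegree_le)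

namespace Triangulation

variable {d : ℕ} {Ω : Set (Pt d)} (M : Triangulation Ω)

theorem isRT_constField (r : ℕ) (i : Fin d) : M.IsRT r (constField i) := by
  refine ⟨fun T _ => ⟨Pi.single i 1, 0, fun j => ?_, MvPolynomial.isHomogeneous_zero _ _ _,
    fun j => by simp [constField]⟩, fun T _ T' _ e _ _ x _ => rfl⟩
  by_cases h : j = i
  · subst h; simp
  · simp [h]

theorem totalDegree_isBrokenRT {r : ℕ} {v : VectorField d d} (hv : M.IsBrokenRT r v)
    {T : Finset (Pt d)} (hT : T ∈ M.cells) (i : Fin d) : (v T i).totalDegree ≤ r + 1 := by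
  obtain ⟨a, b, ha, hb, hab⟩ := hv T hT
  rw [hab i]
  refine (MvPolynomial.totalDegree_add _ _).trans (max_le ((ha i).trans (Nat.le_succ r)) ?_)
  refine (MvPolynomial.totalDegree_mul _ _).trans ?_
  rw [MvPolynomial.totalDegree_X, add_comm]
  exact Nat.add_le_add_right hb.totalDegree_le 1

theorem domInt_zero : M.domInt (fun _ _ => 0) = 0 := by simp [domInt, cellInt]

/-! ### Balances -/

theorem domInt_curlP_eq_skelInt (hd : d = 2 ∨ d = 3) (ω : VectorField d (vdim d)) (i : Fin d) :
    M.domInt (fun T => ev (curlP d (ω T) i))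
      = M.skelInt fun T e x => crossVort d (nrm T e) (evV (ω T) x) i := by
  refine Finset.sum_congr rfl fun T hT => ?_
  obtain ⟨F, hF, hF'⟩ := exists_divP_eq_curlP hd (ω T) i
  beta_reduce
  rw [← hF, cellInt_divP (by omega) (M.card_cell T hT) (M.indep T hT)]
  simp only [hF']

/-- The normal changes sign, while conformity matches the traces: full continuity in the plane,
tangential continuity in space. -/
theorem crossVort_opp (hd : d = 2 ∨ d = 3) {ω : VectorField d (vdim d)}
    (hω : IsSigmaConforming d M ω) {T e : Finset (Pt d)} (hT : T ∈ M.cells) (he : e ∈ facets T)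
    (h : M.IsInternal T e) {x : Pt d} (hx : x ∈ hull e) :
    crossVort d (nrm (M.opp T e) e) (evV (ω (M.opp T e)) x)
      = -crossVort d (nrm T e) (evV (ω T) x) := by
  obtain ⟨h1, h2, h3⟩ := M.opp_spec he h
  rw [M.nrm_opp (by omega) hT he h, crossVort_neg hd]
  congr 1
  rcases hd with rfl | rfl
  · have hsub : ∀ K : Finset (Pt 2), e ∈ facets K → x ∈ hull K := fun K hK =>
      convexHull_mono (Finset.coe_subset.2 (Finset.mem_powersetCard.1 hK).1) hx
    rw [hω _ h1 _ hT x ⟨hsub _ h3, hsub _ he⟩]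
  · exact (hω T hT _ h1 e he h3 x hx).symm

/-- The mean of the curl vanishes if the tangential trace does. -/
theorem domInt_curlP_eq_zero (hd : d = 2 ∨ d = 3) {ω : VectorField d (vdim d)}
    (hω : IsSigmaConforming d M ω) (hω0 : M.ZeroTangentialTrace ω) (i : Fin d) :
    M.domInt (fun T => ev (curlP d (ω T) i)) = 0 := by
  rw [M.domInt_curlP_eq_skelInt hd]
  refine M.skelInt_eq_zero (by omega) _ (fun T hT e he h x hx => ?_) fun T hT e he h x hx => ?_
  · rw [M.crossVort_opp hd hω hT he h hx, Pi.neg_apply]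
  · rw [hω0 T hT e he h x hx, Pi.zero_apply]

theorem dotProduct_nrm_opp (hd : 0 < d) {r : ℕ} {m : VectorField d d} (hm : M.IsRT r m)
    {T e : Finset (Pt d)} (hT : T ∈ M.cells) (he : e ∈ facets T) (h : M.IsInternal T e)
    {x : Pt d} (hx : x ∈ hull e) :
    evV (m (M.opp T e)) x ⬝ᵥ nrm (M.opp T e) e = -(evV (m T) x ⬝ᵥ nrm T e) := by
  obtain ⟨h1, h2, h3⟩ := M.opp_spec he h
  rw [M.nrm_opp hd hT he h, dotProduct_neg, hm.2 T hT _ h1 e he h3 x hx]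

/-- The numerical flux is conservative. -/
theorem skelInt_numFlux_eq_zero (hd : 0 < d) {r : ℕ} {ρ : ScalarField d} {m : VectorField d d}
    (hm : M.IsRT r m) (hm0 : M.ZeroNormalTrace m) (i : Fin d) : M.skelInt (M.numFlux ρ m i) = 0 := by
  refine M.skelInt_eq_zero hd _ (fun T hT e he h x hx => ?_) fun T hT e he h x hx => ?_
  · have h1 := M.dotProduct_nrm_opp hd hm hT he h hx
    have h2 := M.opp_opp hd hT he h
    have h3 : evV (m (M.opp T e)) x ⬝ᵥ nrm T e = evV (m T) x ⬝ᵥ nrm T e :=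
      (hm.2 T hT _ (M.opp_spec he h).1 e he (M.opp_spec he h).2.2 x hx).symm
    have h4 : evV (m T) x ⬝ᵥ nrm (M.opp T e) e = -(evV (m T) x ⬝ᵥ nrm T e) := by
      rw [M.nrm_opp hd hT he h, dotProduct_neg]
    -- Under exchange of sides the normal momentum and the jump are odd, the average and `sMax`
    -- even.
    simp only [numFlux, avg, jump, sMax, h1, h2, h3, h4, neg_div, abs_neg]
    rw [max_comm]
    ring
  · simp [numFlux, jump, M.opp_of_isBoundary h, hm0 T hT e he h x hx]

theorem domInt_convected (hd : 0 < d) {r : ℕ} {Δt : ℝ} {ρ : ScalarField d} {m mS : VectorField d d}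
    (hm : M.IsRT r m) (hm0 : M.ZeroNormalTrace m) (h : M.IsConvected r Δt ρ m mS) (i : Fin d) :
    M.domInt (fun T => ev (mS T i)) = M.domInt (fun T => ev (m T i)) := by
  have := h.2 (constField i) (M.isRT_constField r i)
  simp only [evV_constField, ev_constField, pderiv_constField, ev_zero, mul_zero,
    Finset.sum_const_zero, domInt_zero, dotProduct_single_one, Pi.single_apply, mul_ite, mul_one,
    Finset.sum_ite_eq', Finset.mem_univ, if_true] at this
  rw [show (fun T e x => M.numFlux ρ m i T e x) = M.numFlux ρ m i from rfl,
    M.skelInt_numFlux_eq_zero hd hm hm0] at this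
  simpa [evV] using this

/-- The momentum equation tested with a coordinate vector. -/
theorem momentumEq_constField_iff {D : StepData d} {mS : VectorField d d}
    {ω : VectorField d (vdim d)} {m : VectorField d d} {p : ScalarField d} {P : Pt d → ℝ}
    (i : Fin d) : M.MomentumEq D mS ω m p P (constField i) ↔
      M.domInt (fun T => ev (m T i)) + D.Δt * M.domInt (fun T => ev (curlP d (ω T) i))
        = M.domInt (fun T => ev (mS T i)) - D.Δt * M.bdryInt (fun T e x => P x * nrm T e i) := by
  simp only [MomentumEq, evV_constField, divP_constField, ev_zero, mul_zero, domInt_zero,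
    dotProduct_single_one, single_one_dotProduct, sub_zero, add_zero]
  rfl

/-! ### Passage to the limit -/

theorem tendsto_cellInt_of_tendsto_domInt {F : ℕ → Finset (Pt d) → Pt d → ℝ}
    (hF : ∀ l T x, 0 ≤ F l T x) (h : Tendsto (fun l => M.domInt (F l)) atTop (𝓝 0))
    {T : Finset (Pt d)} (hT : T ∈ M.cells) :
    Tendsto (fun l => cellInt T (F l T)) atTop (𝓝 0) := by
  have hnn : ∀ l K, 0 ≤ cellInt K (F l K) := fun l K => integral_nonneg (hF l K)
  exact squeeze_zero (fun l => hnn l T)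
    (fun l => Finset.single_le_sum (f := fun K => cellInt K (F l K)) (fun K _ => hnn l K) hT) h

/-- The index is shifted because the Newton steps put only the iterates from 1 on into the discrete
spaces, where degrees are bounded. -/
theorem L2TendstoV.tendsto_linear {k n : ℕ} {f : ℕ → VectorField d k} {g : VectorField d k}
    (h : M.L2TendstoV f g) {T : Finset (Pt d)} (hT : T ∈ M.cells)
    (hf : ∀ l i, (f (l + 1) T i).totalDegree ≤ n) (hg : ∀ i, (g T i).totalDegree ≤ n) (i : Fin k)
    (Λ : Poly d →ₗ[ℝ] ℝ) : Tendsto (fun l => Λ (f (l + 1) T i)) atTop (𝓝 (Λ (g T i))) := by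
  refine tendsto_of_cellInt_sq_tendsto_zero (M.card_cell T hT) (M.indep T hT)
    (fun l => hf l i) (hg i) ?_ Λ
  have h1 := (M.tendsto_cellInt_of_tendsto_domInt
    (fun l K x => Finset.sum_nonneg fun j _ => sq_nonneg _) h hT).comp (tendsto_add_atTop_nat 1)
  have hcont : ∀ l j, Continuous fun x : Pt d => (ev (f l T j) x - ev (g T j) x) ^ 2 := fun l j =>
    ((continuous_ev _).sub (continuous_ev _)).pow 2
  refine squeeze_zero (fun l => integral_nonneg fun x => sq_nonneg _) (fun l => ?_) h1
  exact integral_mono (integrableOn_hull T (hcont (l + 1) i))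
    (integrableOn_hull T (continuous_finsetSum _ fun j _ => hcont (l + 1) j))
    fun x => Finset.single_le_sum (f := fun j => (ev (f (l + 1) T j) x - ev (g T j) x) ^ 2)
      (fun j _ => sq_nonneg _) (Finset.mem_univ i)

theorem tendsto_cellInt_curlP (hd : d = 2 ∨ d = 3) {f : ℕ → Fin (vdim d) → Poly d}
    {g : Fin (vdim d) → Poly d} {T : Finset (Pt d)}
    (h : ∀ k (Λ : Poly d →ₗ[ℝ] ℝ), Tendsto (fun l => Λ (f l k)) atTop (𝓝 (Λ (g k)))) (i : Fin d) :
    Tendsto (fun l => cellInt T (ev (curlP d (f l) i))) atTop (𝓝 (cellInt T (ev (curlP d g i)))) := by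
  simp only [← cellIntₗ_apply]
  have h' := fun k j => h k (cellIntₗ T ∘ₗ (MvPolynomial.pderiv j : Derivation ℝ (Poly d) (Poly d)).toLinearMap)
  rcases hd with rfl | rfl
  · fin_cases i
    · exact h' (0 : Fin 1) 1
    · simpa [curlP] using (h' (0 : Fin 1) 0).neg
  · fin_cases i
    · simpa [curlP] using (h' (2 : Fin 3) 1).sub (h' (1 : Fin 3) 2)
    · simpa [curlP] using (h' (0 : Fin 3) 2).sub (h' (2 : Fin 3) 0)
    · simpa [curlP] using (h' (1 : Fin 3) 0).sub (h' (0 : Fin 3) 1)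

/-- The limit of the Newton iteration satisfies the momentum equation, tested with a coordinate
vector. -/
theorem NewtonConverges.momentumEq_constField (hd : d = 2 ∨ d = 3) {r : ℕ} {D : StepData d}
    {ρn S : ScalarField d} {mS : VectorField d d} {ω : VectorField d (vdim d)}
    {m : VectorField d d} {p : ScalarField d}
    (h : M.NewtonConverges BC.outflow r D ρn S mS ω m p) (i : Fin d) :
    M.MomentumEq D mS ω m p D.pbar (constField i) := by
  obtain ⟨hω, hm, -, ωs, ms, ps, -, hstep, hωs, hms, -⟩ := h
  rw [momentumEq_constField_iff]
  -- For a constant test field the pressure iterate disappears and the right-hand side does not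
  -- depend on `l`; the two remaining terms are linear in the iterates.
  have hm' : Tendsto (fun l => M.domInt fun T => ev (ms (l + 1) T i)) atTop
      (𝓝 (M.domInt fun T => ev (m T i))) :=
    tendsto_finsetSum _ fun T hT => L2TendstoV.tendsto_linear M hms hT
      (fun l => M.totalDegree_isBrokenRT (hstep l).2.1.1.1 hT)
      (M.totalDegree_isBrokenRT hm.1.1 hT) i (cellIntₗ T)
  have hω' : Tendsto (fun l => M.domInt fun T => ev (curlP d (ωs (l + 1) T) i)) atTop
      (𝓝 (M.domInt fun T => ev (curlP d (ω T) i))) :=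
    tendsto_finsetSum _ fun T hT => tendsto_cellInt_curlP hd
      (f := fun l => ωs (l + 1) T) (fun k Λ => L2TendstoV.tendsto_linear M hωs hT
        (fun l => totalDegree_le_of_isLocalSigma hd ((hstep l).1.1.1 T hT))
        (totalDegree_le_of_isLocalSigma hd (hω.1.1 T hT)) k Λ) i
  refine tendsto_nhds_unique (hm'.add (hω'.const_mul D.Δt)) (tendsto_const_nhds.congr fun l => ?_)
  -- Constants are admissible test fields because outflow conditions impose no normal trace.
  exact ((M.momentumEq_constField_iff i).1 ((hstep l).2.2.2.2.1 (constField i)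
    ⟨M.isRT_constField r i, fun h => absurd rfl h⟩)).symm

/-! ### Balance of mass -/

theorem domInt_divP_eq_zero (hd : 0 < d) {r : ℕ} {m : VectorField d d} (hm : M.IsRT r m)
    (hm0 : M.ZeroNormalTrace m) : M.domInt (fun T => ev (divP (m T))) = 0 := by
  have : M.domInt (fun T => ev (divP (m T))) = M.skelInt fun T e x => evV (m T) x ⬝ᵥ nrm T e :=
    Finset.sum_congr rfl fun T hT => cellInt_divP hd (M.card_cell T hT) (M.indep T hT) (m T)
  rw [this]
  exact M.skelInt_eq_zero hd _ (fun T hT e he h x hx => M.dotProduct_nrm_opp hd hm hT he h hx) hm0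

theorem skelInt_congr {F G : Finset (Pt d) → Finset (Pt d) → Pt d → ℝ}
    (h : ∀ T ∈ M.cells, ∀ e ∈ facets T, F T e = G T e) : M.skelInt F = M.skelInt G :=
  Finset.sum_congr rfl fun T hT => Finset.sum_congr rfl fun e he => by rw [h T hT e he]

theorem skelInt_zero : M.skelInt (fun _ _ _ => 0) = 0 := by simp [skelInt, facetInt]

theorem sip_eq_zero_of_eq_zero {ε : Finset (Pt d) → ℝ} (hε : ∀ T ∈ M.cells, ε T = 0) (ζ : ℝ)
    (p q : ScalarField d) : M.sip ε ζ p q = 0 := by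
  have h1 : M.domInt (fun T x => ε T * (evV (gradP (p T)) x ⬝ᵥ evV (gradP (q T)) x)) = 0 :=
    Finset.sum_eq_zero fun T hT => by simp [hε T hT, cellInt]
  have h2 : M.skelInt (fun T e x => ζ * ε T / Metric.diam (hull T)
        * M.jump (fun K y => ev (p K) y) T e x * M.jump (fun K y => ev (q K) y) T e x) = 0 := by
    rw [← M.skelInt_zero]
    exact M.skelInt_congr fun T hT e he => by simp [hε T hT]
  have h3 : ∀ p q : ScalarField d, M.skelInt (fun T e x =>
        (∑ i, M.avg (fun K y => ε K * ev (gradP (p K) i) y) T e x * nrm T e i)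
          * M.jump (fun K y => ev (q K) y) T e x) = 0 := by
    intro p q
    rw [← M.skelInt_zero]
    exact M.skelInt_congr fun T hT e he => by
      simp [avg, hε T hT, hε _ (M.opp_mem hT he)]
  rw [sip, h1, h2, h3, h3]
  ring

/-- Constants are in the kernel of the interior penalty form. -/
theorem sip_one_right (ε : Finset (Pt d) → ℝ) (ζ : ℝ) (p : ScalarField d) :
    M.sip ε ζ p (fun _ => 1) = 0 := by
  have hg : ∀ i, gradP (1 : Poly d) i = 0 := fun i => by simp [gradP]
  have hg' : ∀ x : Pt d, evV (gradP (1 : Poly d)) x = 0 := fun x => by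
    funext i; simp [evV, hg]
  simp [sip, hg, hg', jump, avg, domInt_zero, skelInt_zero]

/-- Testing with the indicator of `T`, admissible because `dP_r` is discontinuous, localizes a
balance. -/
theorem domInt_ite_eq_cellInt {T : Finset (Pt d)} [DecidableEq (Finset (Pt d))] (hT : T ∈ M.cells)
    (F : Finset (Pt d) → Pt d → ℝ) :
    M.domInt (fun K x => F K x * ev (if K = T then 1 else 0 : Poly d) x) = cellInt T (F T) := by
  rw [domInt, Finset.sum_eq_single T]
  · simp
  · intro K _ hK
    simp [hK, cellInt]
  · exact fun h => absurd hT h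

/-- Balance of mass on an element in the absence of artificial diffusion. -/
theorem IsDensityUpdate.cellInt_eq (hd : 0 < d) {r : ℕ} {D : StepData d} {ρ ρ' : ScalarField d}
    {m : VectorField d d} (h : M.IsDensityUpdate r D ρ m ρ') (hε : ∀ T ∈ M.cells, D.ερ T = 0)
    {T : Finset (Pt d)} (hT : T ∈ M.cells) :
    cellInt T (fun x => ev (ρ' T) x) = cellInt T (fun x => ev (ρ T) x)
      - D.Δt * ∑ e ∈ facets T, facetInt e (fun x => evV (m T) x ⬝ᵥ nrm T e) := by
  classical
  have hq : M.IsDG r (fun K => if K = T then 1 else 0) := fun K _ => by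
    dsimp only
    split_ifs <;> simp
  have := h.2 _ hq
  rw [M.sip_eq_zero_of_eq_zero hε, mul_zero, add_zero,
    M.domInt_ite_eq_cellInt hT fun K x => ev (ρ' K) x,
    M.domInt_ite_eq_cellInt hT fun K x => ev (ρ K) x,
    M.domInt_ite_eq_cellInt hT fun K x => ev (divP (m K)) x] at this
  rw [this]
  congr 2
  exact cellInt_divP hd (M.card_cell T hT) (M.indep T hT) (m T)

/-- Global conservation of mass. -/
theorem IsDensityUpdate.domInt_eq (hd : 0 < d) {r : ℕ} {D : StepData d} {ρ ρ' : ScalarField d}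
    {m : VectorField d d} (h : M.IsDensityUpdate r D ρ m ρ') (hm : M.IsRT r m)
    (hm0 : M.ZeroNormalTrace m) :
    M.domInt (fun T x => ev (ρ' T) x) = M.domInt (fun T x => ev (ρ T) x) := by
  have := h.2 (fun _ => 1) fun T _ => by simp
  rw [sip_one_right] at this
  simp only [ev_one, mul_one, mul_zero, add_zero] at this
  rw [this, show M.domInt (fun T x => ev (divP (m T)) x) = 0 from M.domInt_divP_eq_zero hd hm hm0]
  ring

end Triangulation

end SemiImplicitFEM

end


/-! ### Assembly of the conservation statements -/

theorem mainTheorem2 (d : ℕ) (hd : d = 2 ∨ d = 3) (Ω : Set (Pt d)) (M : Triangulation Ω)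
    (bc : BC) (r : ℕ) (D : StepData d)
    (hγ : 1 < D.γ) (hcv : 0 < D.cv) (hΔt : 0 < D.Δt) (hζ : 0 < D.ζ)
    (hερ : ∀ T ∈ M.cells, 0 ≤ D.ερ T) (hεm : ∀ T ∈ M.cells, 0 < D.εm T)
    -- the discrete density and momentum at the old time level, the entropy at the new one
    (ρn S : ScalarField d) (mn : VectorField d d)
    (hρn : M.IsDG r ρn) (hρpos : ∀ T ∈ M.cells, ∀ x ∈ hull T, 0 < ev (ρn T) x)
    (hS : M.IsDG r S) (hmn : M.IsRT r mn)
    -- one time step of the scheme, the Newton iteration being convergent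
    (mS : VectorField d d) (hmS : M.IsConvected r D.Δt ρn mn mS)
    (ω : VectorField d (vdim d)) (m : VectorField d d) (p : ScalarField d)
    (hN : M.NewtonConverges bc r D ρn S mS ω m p)
    (ρ : ScalarField d) (hρ : M.IsDensityUpdate r D ρn m ρ)
    -- the normal momentum and the tangential vorticity vanish on the boundary
    (hmn0 : M.ZeroNormalTrace mn) (hm0 : M.ZeroNormalTrace m) (hω0 : M.ZeroTangentialTrace ω) :
    -- local conservation of mass
    ((∀ T ∈ M.cells, D.ερ T = 0) → ∀ T ∈ M.cells,
      cellInt T (fun x => ev (ρ T) x) = cellInt T (fun x => ev (ρn T) x)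
        - D.Δt * ∑ e ∈ facets T, facetInt e (fun x => evV (m T) x ⬝ᵥ nrm T e)) ∧
    -- balance of momentum, and its global conservation
    (∀ P : Pt d → ℝ,
      ((bc = BC.outflow ∧ P = D.pbar) ∨ M.IsBoundaryPressure r D mS ω m p P) →
      (∀ i, M.domInt (fun T x => ev (m T i) x) = M.domInt (fun T x => ev (mn T i) x)
        - D.Δt * M.bdryInt (fun T e x => P x * nrm T e i)) ∧
      ((∀ i, M.bdryInt (fun T e x => P x * nrm T e i) = 0) →
        ∀ i, M.domInt (fun T x => ev (m T i) x) = M.domInt (fun T x => ev (mn T i) x))) ∧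
    -- global conservation of mass
    ((∀ T ∈ M.cells, D.ερ T = 0) ∨ M.ZeroNormalDerivative ρ →
      M.domInt (fun T x => ev (ρ T) x) = M.domInt (fun T x => ev (ρn T) x)) := by
  have hd0 : 0 < d := by omega
  obtain ⟨hω, hm, -⟩ := id hN
  refine ⟨fun hε T hT => Triangulation.IsDensityUpdate.cellInt_eq M hd0 hρ hε hT, fun P hP => ?_,
    fun _ => Triangulation.IsDensityUpdate.domInt_eq M hd0 hρ hm.1 hm0⟩
  have hbal : ∀ i, M.domInt (fun T x => ev (m T i) x) = M.domInt (fun T x => ev (mn T i) x)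
      - D.Δt * M.bdryInt (fun T e x => P x * nrm T e i) := by
    intro i
    -- Outflow: limit of the Newton equations. Boundary pressure: the equation holds on all of
    -- `RT_r`, even if constants are outside the momentum space.
    have hmom : M.MomentumEq D mS ω m p P (constField i) := by
      rcases hP with ⟨rfl, rfl⟩ | hP
      · exact Triangulation.NewtonConverges.momentumEq_constField M hd hN i
      · exact hP _ (M.isRT_constField r i)
    have h := (M.momentumEq_constField_iff i).1 hmom
    rw [M.domInt_curlP_eq_zero hd hω.1.2 hω0, mul_zero, add_zero,
      M.domInt_convected hd0 hmn hmn0 hmS] at h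
    exact h
  exact ⟨hbal, fun h0 i => by rw [hbal i, h0 i, mul_zero, sub_zero]⟩
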